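/- Let $k\ge 0$ be an integer. For a polynomial $f\in\mathbb{Z}[x]$ put $$\mathcal{G}(f)=\gcd\{\phi(|f(n)|) : n\in\mathbb{Z},\ n\ge 1\},$$ where $\phi$ is Euler's totient function and $\phi(0)=0$, so that zero values of $f$ do not affect the greatest common divisor. Let $f\in\mathbb{Z}[x]$ be primitive (its coefficients have greatest common divisor $1$), of degree $k$, and suppose that $f$ splits completely into linear factors over $\mathbb{Q}$. Then no prime $\ell>2k+1$ divides $\mathcal{G}(f)$. Moreover, for every prime $\ell\le 2k+1$ there is a constant $C(k,\ell)$, depending only on $k$ and $\ell$ and not on $f$, such that every power of $\ell$ dividing $\mathcal{G}(f)$ is at most $C(k,\ell)$. -/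

import Mathlib

/-- The greatest common divisor `gcd {φ(|f(n)|) : n ≥ 1}` of the totients of the values of the integer
polynomial `f` at the positive integers. Zero values of `f` contribute `φ(0) = 0`, which does not
change a greatest common divisor. -/
noncomputable def totientGcd (f : Polynomial ℤ) : ℕ :=
  Nat.setGcd {m : ℕ | ∃ n : ℕ, 1 ≤ n ∧ m = Nat.totient (f.eval (n : ℤ)).natAbs}

/-! Since φ(N)·rad(N) = N·∏(p − 1), the valuation of φ(N) at ℓ is at most v_ℓ(N) + ∑ v_ℓ(p − 1) over
the primes p ∣ N (`padicValNat_totient_le`). By Gauss's lemma f(n) divides the product of the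
primitive linear forms of its roots (`eval_dvd_prod_linForm`). So it suffices to find one n ≥ 1 at
which the forms are nonzero, have little divisibility by ℓ, and have few prime factors p with p − 1
highly divisible by ℓ.

Large ℓ: in a progression modulo ℓ where all forms are prime to ℓ, the forms must avoid every prime
p ≡ 1 mod ℓ. This is a sieve of dimension κ ≤ k/(ℓ − 1) < 1/2, in which one sifts up to the size of
the values themselves. The beta-sieve with β = 1 is still positive there on average over the levels
2^j, j < J (`mul_siftedDensity_le_sum_lowerSieve`). If no integer survived, each lower main term,
relative to the dual density, would be O(1/j), because the remainder saves a logarithm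
(`mul_sieveRemainder_le`). Then J^(1 − 2κ) would be O(log J), a contradiction
(`exists_linForm_avoid_primes`).

Small ℓ: only the primes p ≡ 1 modulo a fixed high power ℓ^e matter, and their density 1/φ(ℓ^e) is
tiny. The fundamental lemma removes the small primes, so that the rough parts of the forms have
boundedly many prime factors; a union bound removes the medium-sized primes p ≡ 1 mod ℓ^e
(`exists_linForm_avoid_small_primes`). A remaining prime of this kind is so large that it is the
whole rough part. This case is made harmless beforehand: the base point is chosen with rough parts
not 1 modulo ℓ^3, and the modulus preserves this (`exists_smoothRoughValues_not_modEq_one`). The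
coefficients of f influence only the scale 2^B, not e or the number of factors, so the bound is
uniform in f. -/

open Finset

/-! ### The beta-sieve as a recursion -/

/-- The pair of the upper and the lower beta-sieve for the primes up to `N` and the level `2 ^ j`,
evaluated on the local densities `h`. The size of `p` is measured by `Nat.clog 2 p`. -/
noncomputable def betaSieve (β : ℕ) (h : ℕ → ℝ) : ℕ → (ℕ → ℝ) × (ℕ → ℝ)
  | 0 => (fun _ => 1, fun _ => 1)
  | N + 1 =>
    -- Buchstab's recursion with truncation. Applied to the hits of one integer it gives the sieve
    -- at that integer; applied to densities it gives the main term.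
    (fun j => if j < Nat.clog 2 (N + 1) then (betaSieve β h N).1 j else
        (betaSieve β h N).1 j - h (N + 1) * (betaSieve β h N).2 (j - Nat.clog 2 (N + 1)),
     fun j => if j < β * Nat.clog 2 (N + 1) then 0 else
        (betaSieve β h N).2 j - h (N + 1) * (betaSieve β h N).1 (j - Nat.clog 2 (N + 1)))

/-- The upper beta-sieve. -/
noncomputable def upperSieve (β : ℕ) (h : ℕ → ℝ) (N j : ℕ) : ℝ := (betaSieve β h N).1 j

/-- The lower beta-sieve. -/
noncomputable def lowerSieve (β : ℕ) (h : ℕ → ℝ) (N j : ℕ) : ℝ := (betaSieve β h N).2 j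

section Recursion

variable (β : ℕ) (h : ℕ → ℝ) (N j : ℕ)

@[simp] lemma upperSieve_zero : upperSieve β h 0 j = 1 := rfl

@[simp] lemma lowerSieve_zero : lowerSieve β h 0 j = 1 := rfl

lemma upperSieve_succ : upperSieve β h (N + 1) j =
    if j < Nat.clog 2 (N + 1) then upperSieve β h N j else
      upperSieve β h N j - h (N + 1) * lowerSieve β h N (j - Nat.clog 2 (N + 1)) := rfl

lemma lowerSieve_succ : lowerSieve β h (N + 1) j =
    if j < β * Nat.clog 2 (N + 1) then 0 else
      lowerSieve β h N j - h (N + 1) * upperSieve β h N (j - Nat.clog 2 (N + 1)) := rfl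

variable {N j}

lemma lowerSieve_eq_zero (hj : j < β * Nat.clog 2 N) : lowerSieve β h N j = 0 := by
  cases N with
  | zero => simp at hj
  | succ N => rw [lowerSieve_succ, if_pos hj]

end Recursion

/-- The density of the integers that avoid all the local conditions up to `N`. -/
noncomputable def siftedDensity (h : ℕ → ℝ) (N : ℕ) : ℝ := ∏ m ∈ Icc 1 N, (1 - h m)

/-- The product of the `1 + h m` up to `N`. -/
noncomputable def dualDensity (h : ℕ → ℝ) (N : ℕ) : ℝ := ∏ m ∈ Icc 1 N, (1 + h m)

lemma siftedDensity_succ (h : ℕ → ℝ) (N : ℕ) :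
    siftedDensity h (N + 1) = siftedDensity h N * (1 - h (N + 1)) := by
  rw [siftedDensity, Finset.prod_Icc_succ_top (by omega)]; rfl

lemma dualDensity_succ (h : ℕ → ℝ) (N : ℕ) :
    dualDensity h (N + 1) = dualDensity h N * (1 + h (N + 1)) := by
  rw [dualDensity, Finset.prod_Icc_succ_top (by omega)]; rfl

lemma siftedDensity_nonneg {h : ℕ → ℝ} (h1 : ∀ m, h m ≤ 1) (N : ℕ) : 0 ≤ siftedDensity h N :=
  prod_nonneg fun m _ => by linarith [h1 m]

lemma one_le_dualDensity {h : ℕ → ℝ} (h0 : ∀ m, 0 ≤ h m) (N : ℕ) : 1 ≤ dualDensity h N := by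
  induction N with
  | zero => simp [dualDensity]
  | succ N ih => rw [dualDensity_succ]; nlinarith [h0 (N + 1)]

lemma dualDensity_mono {h : ℕ → ℝ} (h0 : ∀ m, 0 ≤ h m) : Monotone (dualDensity h) :=
  monotone_nat_of_le_succ fun N => by
    rw [dualDensity_succ]; nlinarith [h0 (N + 1), one_le_dualDensity h0 N]

/-- The beta-sieves enclose the sifted density. -/
theorem lowerSieve_le_siftedDensity_le_upperSieve (β : ℕ) {h : ℕ → ℝ} (h0 : ∀ m, 0 ≤ h m)
    (h1 : ∀ m, h m ≤ 1) (N : ℕ) : ∀ j, lowerSieve β h N j ≤ siftedDensity h N ∧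
      siftedDensity h N ≤ upperSieve β h N j := by
  induction N with
  | zero => intro j; simp [siftedDensity]
  | succ N ih =>
    intro j
    have hV := siftedDensity_nonneg h1 N
    have hp0 := h0 (N + 1)
    have hp1 := h1 (N + 1)
    have e1 := ih j
    have e2 := ih (j - Nat.clog 2 (N + 1))
    rw [lowerSieve_succ, upperSieve_succ, siftedDensity_succ]
    constructor
    · split_ifs
      · nlinarith
      · nlinarith [mul_le_mul_of_nonneg_left e2.2 hp0]
    · split_ifs
      · nlinarith
      · nlinarith [mul_le_mul_of_nonneg_left e2.1 hp0]

lemma siftedDensity_le_one {h : ℕ → ℝ} (h0 : ∀ m, 0 ≤ h m) (h1 : ∀ m, h m ≤ 1) (N : ℕ) :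
    siftedDensity h N ≤ 1 :=
  prod_le_one (fun m _ => by linarith [h1 m]) fun m _ => by linarith [h0 m]

/-! ### The sieves with `β = 1`, averaged over the level -/

/-- One step of the mean difference of the two sieves over the levels below `J`. -/
lemma sum_upper_sub_lower_succ_le {h : ℕ → ℝ} (h0 : ∀ m, 0 ≤ h m) (h1 : ∀ m, h m ≤ 1)
    {N J : ℕ} (hJ : Nat.clog 2 (N + 1) ≤ J) :
    ∑ j ∈ range J, (upperSieve 1 h (N + 1) j - lowerSieve 1 h (N + 1) j) ≤
      (1 + h (N + 1)) * ∑ j ∈ range J, (upperSieve 1 h N j - lowerSieve 1 h N j) +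
        ∑ j ∈ range (Nat.clog 2 (N + 1)), lowerSieve 1 h N j := by
  set a := Nat.clog 2 (N + 1) with ha
  have hE : ∀ j, 0 ≤ upperSieve 1 h N j - lowerSieve 1 h N j := fun j => by
    have := lowerSieve_le_siftedDensity_le_upperSieve 1 h0 h1 N j
    linarith [this.1, this.2]
  obtain ⟨b, rfl⟩ := Nat.exists_eq_add_of_le hJ
  rw [sum_range_add, sum_range_add (fun j => upperSieve 1 h N j - lowerSieve 1 h N j)]
  -- With `β = 1` both sieves are truncated at the same threshold; below it, the difference grows
  -- only by the discarded lower sieve.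
  have s1 : ∑ j ∈ range a, (upperSieve 1 h (N + 1) j - lowerSieve 1 h (N + 1) j) =
      ∑ j ∈ range a, (upperSieve 1 h N j - lowerSieve 1 h N j) +
        ∑ j ∈ range a, lowerSieve 1 h N j := by
    rw [← sum_add_distrib]
    refine sum_congr rfl fun j hj => ?_
    have hj := mem_range.1 hj
    rw [upperSieve_succ, lowerSieve_succ, if_pos hj, if_pos (by rw [one_mul]; exact hj)]
    ring
  have s2 : ∑ j ∈ range b, (upperSieve 1 h (N + 1) (a + j) - lowerSieve 1 h (N + 1) (a + j)) =
      ∑ j ∈ range b, (upperSieve 1 h N (a + j) - lowerSieve 1 h N (a + j)) +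
        h (N + 1) * ∑ j ∈ range b, (upperSieve 1 h N j - lowerSieve 1 h N j) := by
    rw [mul_sum, ← sum_add_distrib]
    refine sum_congr rfl fun j _ => ?_
    rw [upperSieve_succ, lowerSieve_succ, if_neg (by omega), if_neg (by omega), ← ha]
    simp only [add_tsub_cancel_left]
    ring
  have s3 : ∑ j ∈ range b, (upperSieve 1 h N j - lowerSieve 1 h N j) ≤
      ∑ j ∈ range a, (upperSieve 1 h N j - lowerSieve 1 h N j) +
        ∑ j ∈ range b, (upperSieve 1 h N (a + j) - lowerSieve 1 h N (a + j)) := by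
    rw [← sum_range_add (fun j => upperSieve 1 h N j - lowerSieve 1 h N j)]
    exact sum_le_sum_of_subset_of_nonneg (range_mono (by omega)) fun j _ _ => hE j
  rw [s1, s2]
  nlinarith [mul_le_mul_of_nonneg_left s3 (h0 (N + 1))]

/-- The mean difference of the two sieves with `β = 1` is controlled by the lower sieves whose
level equals the largest sifting prime. -/
lemma sum_upper_sub_lower_le {h : ℕ → ℝ} (h0 : ∀ m, 0 ≤ h m) (h1 : ∀ m, h m ≤ 1) {J : ℕ} (N : ℕ)
    (hN : N ≤ 2 ^ J) :
    ∑ j ∈ range J, (upperSieve 1 h N j - lowerSieve 1 h N j) ≤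
      dualDensity h N * ∑ j ∈ range (Nat.clog 2 N),
        max (lowerSieve 1 h (2 ^ j) j) 0 / dualDensity h (2 ^ j) := by
  induction N with
  | zero => simp
  | succ N ih =>
    have hc : Nat.clog 2 (N + 1) ≤ J := (Nat.clog_le_iff_le_pow one_lt_two).2 hN
    refine (sum_upper_sub_lower_succ_le h0 h1 hc).trans ?_
    have ih := ih (by omega)
    have hp := h0 (N + 1)
    have hG := one_le_dualDensity h0 N
    have hmono : Nat.clog 2 N ≤ Nat.clog 2 (N + 1) := Nat.clog_mono_right 2 (by omega)
    have hnn : ∀ j, 0 ≤ max (lowerSieve 1 h (2 ^ j) j) 0 / dualDensity h (2 ^ j) := fun j =>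
      div_nonneg (le_max_right _ _) (zero_le_one.trans (one_le_dualDensity h0 _))
    -- The lower sieve vanishes at levels below `clog 2 N`, so a new term arises only when `clog 2`
    -- jumps at `N + 1`, that is, when `N = 2 ^ j`.
    have key : ∑ j ∈ range (Nat.clog 2 (N + 1)), lowerSieve 1 h N j ≤
        dualDensity h N * ∑ j ∈ Ico (Nat.clog 2 N) (Nat.clog 2 (N + 1)),
          max (lowerSieve 1 h (2 ^ j) j) 0 / dualDensity h (2 ^ j) := by
      rw [← sum_range_add_sum_Ico _ hmono, sum_eq_zero (s := range _), zero_add, mul_sum]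
      · refine sum_le_sum fun j hj => ?_
        have hj := mem_Ico.1 hj
        have e1 : N ≤ 2 ^ j := (Nat.clog_le_iff_le_pow one_lt_two).1 hj.1
        have e2 : 2 ^ j < N + 1 := (Nat.lt_clog_iff_pow_lt one_lt_two).1 hj.2
        have e : 2 ^ j = N := by omega
        rw [e, mul_div_cancel₀ _ (by positivity)]
        exact le_max_left _ _
      · intro j hj
        exact lowerSieve_eq_zero _ _ (by rw [one_mul]; exact mem_range.1 hj)
    rw [← sum_range_add_sum_Ico (fun j => max (lowerSieve 1 h (2 ^ j) j) 0 /
      dualDensity h (2 ^ j)) hmono, dualDensity_succ]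
    have hS : 0 ≤ ∑ j ∈ Ico (Nat.clog 2 N) (Nat.clog 2 (N + 1)),
        max (lowerSieve 1 h (2 ^ j) j) 0 / dualDensity h (2 ^ j) := sum_nonneg fun j _ => hnn j
    nlinarith [mul_le_mul_of_nonneg_left ih (by linarith : 0 ≤ 1 + h (N + 1)),
      mul_nonneg (mul_nonneg hp (zero_le_one.trans hG)) hS]

/-- The lower sieves with `β = 1` are positive on average in any dimension below `1 / 2`. -/
theorem mul_siftedDensity_le_sum_lowerSieve {h : ℕ → ℝ} (h0 : ∀ m, 0 ≤ h m) (h1 : ∀ m, h m ≤ 1)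
    (J : ℕ) : J * siftedDensity h (2 ^ J) ≤ dualDensity h (2 ^ J) *
      ∑ j ∈ range J, max (lowerSieve 1 h (2 ^ j) j) 0 / dualDensity h (2 ^ j) := by
  have key := sum_upper_sub_lower_le h0 h1 (J := J) (2 ^ J) le_rfl
  rw [Nat.clog_pow _ _ one_lt_two] at key
  refine le_trans ?_ key
  have : ∑ j ∈ range J, siftedDensity h (2 ^ J) = J * siftedDensity h (2 ^ J) := by simp
  rw [← this]
  refine sum_le_sum fun j hj => ?_
  -- At the limit `2 ^ J` every lower sieve of level below `J` is zero, and the difference is the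
  -- upper sieve alone.
  rw [lowerSieve_eq_zero _ _ (by rw [Nat.clog_pow _ _ one_lt_two, one_mul]; exact mem_range.1 hj),
    sub_zero]
  exact (lowerSieve_le_siftedDensity_le_upperSieve 1 h0 h1 _ j).2

/-! ### Sifting integers by residue classes -/

/-- The indicator function of the moduli `p` for which `t` lies in the residue set `Ω p`. -/
noncomputable def residueHit (Ω : ℕ → Finset ℕ) (t p : ℕ) : ℝ := if t % p ∈ Ω p then 1 else 0

/-- The density of the residue set `Ω p`. -/
noncomputable def residueDensity (Ω : ℕ → Finset ℕ) (p : ℕ) : ℝ := #(Ω p) / p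

/-- The weighted number of the products of primes up to `N` whose size is at most `2 ^ j`. -/
noncomputable def sieveRemainder (Ω : ℕ → Finset ℕ) : ℕ → ℕ → ℝ
  | 0 => fun _ => 1
  | N + 1 => fun j => sieveRemainder Ω N j + if j < Nat.clog 2 (N + 1) then 0 else
      #(Ω (N + 1)) * sieveRemainder Ω N (j - Nat.clog 2 (N + 1))

lemma sieveRemainder_nonneg (Ω : ℕ → Finset ℕ) (N : ℕ) : ∀ j, 0 ≤ sieveRemainder Ω N j := by
  induction N with
  | zero => intro j; simp [sieveRemainder]
  | succ N ih =>
    intro j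
    have := ih j
    have := ih (j - Nat.clog 2 (N + 1))
    simp only [sieveRemainder]
    split_ifs <;> positivity

lemma residueDensity_nonneg (Ω : ℕ → Finset ℕ) (p : ℕ) : 0 ≤ residueDensity Ω p := by
  unfold residueDensity; positivity

lemma abs_sum_modEq_sub_le (x c : ℕ) {m : ℕ} (hm : 0 < m) :
    |∑ _t ∈ range x with _t ≡ c [MOD m], (1 : ℝ) - x / m| ≤ 1 := by
  have h1 : (∑ _t ∈ range x with _t ≡ c [MOD m], (1 : ℝ)) =
      ((x / m + if c % m < x % m then 1 else 0 : ℕ) : ℝ) := by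
    rw [← Nat.count_modEq_card x hm c, Nat.count_eq_card_filter_range]; simp
  have hm' : (0 : ℝ) < m := by exact_mod_cast hm
  have h2 : (x : ℝ) = m * (x / m : ℕ) + (x % m : ℕ) := by exact_mod_cast (Nat.div_add_mod x m).symm
  have h3 : ((x % m : ℕ) : ℝ) < m := by exact_mod_cast Nat.mod_lt x hm
  have h4 : (x : ℝ) / m = (x / m : ℕ) + (x % m : ℕ) / m := by
    conv_lhs => rw [h2]
    field_simp
  have h5 : ((x % m : ℕ) : ℝ) / m < 1 := (div_lt_one hm').2 h3
  have h6 : 0 ≤ ((x % m : ℕ) : ℝ) / m := by positivity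
  rw [h1, h4, abs_le]
  split_ifs <;> constructor <;> push_cast <;> linarith

section Distribution

variable {Ω : ℕ → Finset ℕ}

/-- Splitting a residue class according to the residues in `Ω p`. -/
lemma sum_modEq_residueHit_mul (hΩ : ∀ p, ∀ ω ∈ Ω p, ω < p) {x c m p : ℕ} (hp : Nat.Coprime m p)
    (F : ℕ → ℝ) :
    ∑ t ∈ range x with t ≡ c [MOD m], residueHit Ω t p * F t =
      ∑ ω ∈ Ω p, ∑ t ∈ range x with t ≡ Nat.chineseRemainder hp c ω [MOD m * p], F t := by
  have : ∀ ω ∈ Ω p, (∑ t ∈ range x with t ≡ Nat.chineseRemainder hp c ω [MOD m * p], F t) =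
      ∑ t ∈ range x with t ≡ c [MOD m], if t % p = ω then F t else 0 := by
    intro ω hω
    rw [← sum_filter, filter_filter]
    refine sum_congr (filter_congr fun t _ => ?_) fun _ _ => rfl
    have e1 := (Nat.chineseRemainder hp c ω).2.1
    have e2 := (Nat.chineseRemainder hp c ω).2.2
    rw [← Nat.modEq_and_modEq_iff_modEq_mul hp]
    constructor
    · rintro ⟨a1, a2⟩
      refine ⟨a1.trans e1, ?_⟩
      have := a2.trans e2
      rwa [Nat.ModEq, Nat.mod_eq_of_lt (hΩ p ω hω)] at this
    · rintro ⟨a1, a2⟩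
      refine ⟨a1.trans e1.symm, Nat.ModEq.trans ?_ e2.symm⟩
      rw [Nat.ModEq, Nat.mod_eq_of_lt (hΩ p ω hω), a2]
  rw [sum_congr rfl this, sum_comm]
  refine sum_congr rfl fun t _ => ?_
  rw [sum_ite_eq, residueHit]
  split_ifs <;> simp

/-- The sieves evaluated on the hits of an integer have, in every residue class, the expected
mean value up to the sieve remainder. -/
theorem abs_sum_sieve_sub_le (hΩ : ∀ p, ∀ ω ∈ Ω p, ω < p)
    (hco : ∀ p q, p ≠ q → (Ω p).Nonempty → (Ω q).Nonempty → Nat.Coprime p q) {β : ℕ} (hβ : 1 ≤ β)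
    (x N : ℕ) :
    ∀ (j m c : ℕ), 0 < m → (∀ p ≤ N, (Ω p).Nonempty → Nat.Coprime m p) →
      |∑ t ∈ range x with t ≡ c [MOD m], upperSieve β (residueHit Ω t) N j -
        x / m * upperSieve β (residueDensity Ω) N j| ≤ sieveRemainder Ω N j ∧
      |∑ t ∈ range x with t ≡ c [MOD m], lowerSieve β (residueHit Ω t) N j -
        x / m * lowerSieve β (residueDensity Ω) N j| ≤ sieveRemainder Ω N j := by
  induction N with
  | zero =>
    intro j m c hm _
    simpa [sieveRemainder] using abs_sum_modEq_sub_le x c hm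
  | succ N ih =>
    intro j m c hm hmp
    have hmp' : ∀ p ≤ N, (Ω p).Nonempty → Nat.Coprime m p := fun p hp => hmp p (by omega)
    set a := Nat.clog 2 (N + 1) with ha
    -- A hit at `N + 1` refines a class modulo `m` into classes modulo `m * (N + 1)`. This is why
    -- the induction must run over all classes whose modulus is prime to the remaining sifting
    -- moduli.
    have step : ∀ (G : (ℕ → ℝ) → ℝ) (R : ℝ), (∀ (m c : ℕ), 0 < m →
        (∀ p ≤ N, (Ω p).Nonempty → Nat.Coprime m p) →
        |∑ t ∈ range x with t ≡ c [MOD m], G (residueHit Ω t) -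
          x / m * G (residueDensity Ω)| ≤ R) →
        |∑ t ∈ range x with t ≡ c [MOD m], residueHit Ω t (N + 1) * G (residueHit Ω t) -
          x / m * (residueDensity Ω (N + 1) * G (residueDensity Ω))| ≤ #(Ω (N + 1)) * R := by
      intro G R hG
      rcases (Ω (N + 1)).eq_empty_or_nonempty with he | hne
      · simp [residueHit, residueDensity, he]
      have hcop := hmp (N + 1) le_rfl hne
      rw [sum_modEq_residueHit_mul hΩ hcop]
      have e : (x : ℝ) / m * (residueDensity Ω (N + 1) * G (residueDensity Ω)) =
          ∑ ω ∈ Ω (N + 1), x / ((m * (N + 1) : ℕ) : ℝ) * G (residueDensity Ω) := by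
        rw [sum_const, nsmul_eq_mul, residueDensity]
        have : (m : ℝ) ≠ 0 := by positivity
        push_cast
        field_simp
      rw [e, ← sum_sub_distrib]
      refine (abs_sum_le_sum_abs _ _).trans ?_
      rw [← nsmul_eq_mul, ← sum_const]
      refine sum_le_sum fun ω _ => hG _ _ (by positivity) fun p hp hpne => ?_
      exact Nat.Coprime.mul_left (hmp' p hp hpne) (hco _ _ (by omega) hne hpne)
    have hR := sieveRemainder_nonneg Ω N
    constructor
    · simp only [upperSieve_succ, sieveRemainder, ← ha]
      split_ifs with hj
      · simpa using (ih j m c hm hmp').1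
      · rw [sum_sub_distrib, mul_sub]
        have i1 := (ih j m c hm hmp').1
        have i2 := step (fun h => lowerSieve β h N (j - a)) _ fun m c hm hmp =>
          (ih (j - a) m c hm hmp).2
        rw [sub_sub_sub_comm]
        exact (abs_sub _ _).trans (add_le_add i1 i2)
    · simp only [lowerSieve_succ, sieveRemainder, ← ha]
      have hnn : 0 ≤ sieveRemainder Ω N j + if j < a then 0 else
          (#(Ω (N + 1)) : ℝ) * sieveRemainder Ω N (j - a) := by
        have := hR j
        have := hR (j - a)
        split_ifs <;> positivity
      split_ifs with hj hj2 hj2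
      · simpa [hj2] using hR j
      · simpa [hj2] using hnn
      · exact absurd hj2 (by have := Nat.le_mul_of_pos_left a hβ; omega)
      · rw [sum_sub_distrib, mul_sub]
        have i1 := (ih j m c hm hmp').2
        have i2 := step (fun h => upperSieve β h N (j - a)) _ fun m c hm hmp =>
          (ih (j - a) m c hm hmp).1
        rw [sub_sub_sub_comm]
        exact (abs_sub _ _).trans (add_le_add i1 i2)

end Distribution

/-- The lower sieve is not positive at an integer that is hit. -/
lemma lowerSieve_residueHit_nonpos {Ω : ℕ → Finset ℕ} (β : ℕ) {t N p : ℕ} (hp : p ∈ Icc 1 N)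
    (hhit : t % p ∈ Ω p) (j : ℕ) : lowerSieve β (residueHit Ω t) N j ≤ 0 := by
  refine (lowerSieve_le_siftedDensity_le_upperSieve β (fun m => ?_) (fun m => ?_) N j).1.trans
    (le_of_eq ?_)
  · unfold residueHit; split_ifs <;> norm_num
  · unfold residueHit; split_ifs <;> norm_num
  · exact prod_eq_zero hp (by simp [residueHit, hhit])

/-! ### The sieve remainder and its logarithmic saving -/

section Remainder

variable {Ω : ℕ → Finset ℕ}

lemma sieveRemainder_eq_sum (Ω : ℕ → Finset ℕ) (N : ℕ) : ∀ j, sieveRemainder Ω N j =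
    ∑ T ∈ (Icc 1 N).powerset,
      if ∑ p ∈ T, Nat.clog 2 p ≤ j then ∏ p ∈ T, (#(Ω p) : ℝ) else 0 := by
  induction N with
  | zero => intro j; simp [sieveRemainder]
  | succ N ih =>
    intro j
    have hnot : N + 1 ∉ Icc 1 N := by simp
    rw [← insert_Icc_right_eq_Icc_add_one (by omega : 1 ≤ N + 1), sum_powerset_insert hnot]
    simp only [sieveRemainder]
    rw [ih]
    congr 1
    split_ifs with hj
    · refine (sum_eq_zero fun T hT => if_neg ?_).symm
      rw [sum_insert (fun hmem => hnot (mem_powerset.1 hT hmem))]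
      omega
    · rw [ih, mul_sum]
      refine sum_congr rfl fun T hT => ?_
      have hT' : N + 1 ∉ T := fun hmem => hnot (mem_powerset.1 hT hmem)
      rw [sum_insert hT', prod_insert hT', mul_ite, mul_zero]
      exact if_congr (by omega) rfl rfl

lemma prod_le_two_pow_sum_clog (T : Finset ℕ) :
    ∏ p ∈ T, (p : ℝ) ≤ 2 ^ ∑ p ∈ T, Nat.clog 2 p := by
  rw [← prod_pow_eq_pow_sum]
  exact prod_le_prod (fun _ _ => by positivity) fun p _ => by
    exact_mod_cast Nat.le_pow_clog one_lt_two p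

/-- Rankin's bound for one term of the sieve remainder. -/
lemma prod_card_mul_two_pow_le {N j : ℕ} {T : Finset ℕ} (hT : T ⊆ Icc 1 N)
    (hj : ∑ p ∈ T, Nat.clog 2 p ≤ j) :
    (∏ p ∈ T, (#(Ω p) : ℝ)) * 2 ^ (j - ∑ p ∈ T, Nat.clog 2 p) ≤
      2 ^ j * ∏ p ∈ T, residueDensity Ω p := by
  have hpos : 0 < ∏ p ∈ T, (p : ℝ) := prod_pos fun p hp => by
    exact_mod_cast (mem_Icc.1 (hT hp)).1
  simp only [residueDensity]
  rw [prod_div_distrib, pow_sub₀ _ two_ne_zero hj, ← div_eq_mul_inv, mul_div_assoc', mul_div_assoc',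
    mul_comm]
  exact div_le_div_of_nonneg_left (by positivity) hpos (prod_le_two_pow_sum_clog T)

lemma sum_powerset_prod_residueDensity (N : ℕ) :
    ∑ T ∈ (Icc 1 N).powerset, ∏ p ∈ T, residueDensity Ω p = dualDensity (residueDensity Ω) N := by
  rw [dualDensity, prod_one_add]

/-- After Rankin's bound the level condition can be dropped, and the sum over all subsets is an
Euler product. -/
lemma sum_rankin_le (N j : ℕ) : (∑ T ∈ (Icc 1 N).powerset, if ∑ p ∈ T, Nat.clog 2 p ≤ j then
    (∏ p ∈ T, (#(Ω p) : ℝ)) * 2 ^ (j - ∑ p ∈ T, Nat.clog 2 p) else 0) ≤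
      2 ^ j * dualDensity (residueDensity Ω) N := by
  rw [← sum_powerset_prod_residueDensity, mul_sum]
  refine sum_le_sum fun T hT => ?_
  split_ifs with h
  · exact prod_card_mul_two_pow_le (mem_powerset.1 hT) h
  · exact mul_nonneg (by positivity) (prod_nonneg fun p _ => residueDensity_nonneg Ω p)

lemma sieveRemainder_le_two_pow_mul (Ω : ℕ → Finset ℕ) (N j : ℕ) :
    sieveRemainder Ω N j ≤ 2 ^ j * dualDensity (residueDensity Ω) N := by
  refine le_trans ?_ (sum_rankin_le N j)
  rw [sieveRemainder_eq_sum]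
  refine sum_le_sum fun T _ => ?_
  split_ifs
  · exact le_mul_of_one_le_right (by positivity) (one_le_pow₀ one_le_two)
  · exact le_rfl

/-- The marked element `p` is removed from `T`, which lowers the size by `a p`. Forgetting that the
remaining set omits `p` only enlarges the sum. -/
lemma sum_powerset_mem_le {S : Finset ℕ} {p : ℕ} (hp : p ∈ S) (a : ℕ → ℕ) (f : ℕ → ℝ)
    (hf : ∀ q, 0 ≤ f q) {j : ℕ} :
    (∑ T ∈ S.powerset, if p ∈ T ∧ ∑ q ∈ T, a q ≤ j then (∏ q ∈ T, f q) * (a p : ℝ) else 0) ≤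
      ∑ T ∈ S.powerset, if ∑ q ∈ T, a q + a p ≤ j then
        (∏ q ∈ T, f q) * (f p * (a p : ℝ)) else 0 := by
  have hS := insert_erase hp
  have hnn : ∀ T : Finset ℕ, 0 ≤ if ∑ q ∈ T, a q + a p ≤ j then
      (∏ q ∈ T, f q) * (f p * (a p : ℝ)) else 0 := fun T => by
    have h1 : 0 ≤ ∏ q ∈ T, f q := prod_nonneg fun q _ => hf q
    have h2 := hf p
    split_ifs
    · positivity
    · exact le_rfl
  have hsub : (S.erase p).powerset ⊆ S.powerset := powerset_mono.2 (erase_subset p S)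
  refine le_trans (le_of_eq ?_) (sum_le_sum_of_subset_of_nonneg hsub fun T _ _ => hnn T)
  have hnot : ∀ T ∈ (S.erase p).powerset, p ∉ T := fun T hT h =>
    notMem_erase p _ (mem_powerset.1 hT h)
  have split := sum_powerset_insert (notMem_erase p S) (fun T =>
    if p ∈ T ∧ ∑ q ∈ T, a q ≤ j then (∏ q ∈ T, f q) * (a p : ℝ) else 0)
  rw [hS] at split
  rw [split, sum_eq_zero fun T hT => if_neg fun h => hnot T hT h.1, zero_add]
  refine sum_congr rfl fun T hT => ?_
  have hpT := hnot T hT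
  rw [sum_insert hpT, prod_insert hpT, add_comm (a p)]
  exact if_congr (by simp) (by ring) rfl

/-- The sieve remainder saves the logarithm of its level. -/
lemma mul_sieveRemainder_le {K : ℝ} (N j : ℕ)
    (hK : ∀ i, ∑ p ∈ Icc 1 N with Nat.clog 2 p ≤ i, (#(Ω p) : ℝ) * Nat.clog 2 p ≤ K * 2 ^ i) :
    j * sieveRemainder Ω N j ≤ (K + 1) * 2 ^ j * dualDensity (residueDensity Ω) N := by
  set A : Finset ℕ → ℕ := fun T => ∑ p ∈ T, Nat.clog 2 p with hA
  set w : Finset ℕ → ℝ := fun T => ∏ p ∈ T, (#(Ω p) : ℝ) with hw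
  have hw0 : ∀ T, 0 ≤ w T := fun T => prod_nonneg fun _ _ => by positivity
  have hK0 : 0 ≤ K := by
    have := (sum_nonneg fun p _ => by positivity).trans (hK 0)
    simpa using this
  have h1 := sum_rankin_le (Ω := Ω) N j
  -- The size `A T` is a sum over the members of `T`. Removing the marked member leaves a sum over
  -- sizes at most `j - A T`, to which `hK` applies.
  have h2 : (∑ T ∈ (Icc 1 N).powerset, if A T ≤ j then w T * (A T : ℝ) else 0) ≤
      K * ∑ T ∈ (Icc 1 N).powerset, if A T ≤ j then w T * 2 ^ (j - A T) else 0 := by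
    calc (∑ T ∈ (Icc 1 N).powerset, if A T ≤ j then w T * (A T : ℝ) else 0)
        = ∑ p ∈ Icc 1 N, ∑ T ∈ (Icc 1 N).powerset,
            if p ∈ T ∧ A T ≤ j then w T * (Nat.clog 2 p : ℝ) else 0 := by
          rw [sum_comm]
          refine sum_congr rfl fun T hT => ?_
          split_ifs with h
          · simp only [h, and_true]
            rw [← sum_filter, filter_mem_eq_inter, inter_eq_right.2 (mem_powerset.1 hT), ← mul_sum,
              ← Nat.cast_sum]
          · simp [h]
      _ ≤ ∑ p ∈ Icc 1 N, ∑ T ∈ (Icc 1 N).powerset,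
            if A T + Nat.clog 2 p ≤ j then w T * (#(Ω p) * (Nat.clog 2 p : ℝ)) else 0 := by
          exact sum_le_sum fun p hp => sum_powerset_mem_le hp _ _ fun _ => by positivity
      _ = ∑ T ∈ (Icc 1 N).powerset, ∑ p ∈ Icc 1 N,
            if A T + Nat.clog 2 p ≤ j then w T * (#(Ω p) * (Nat.clog 2 p : ℝ)) else 0 := sum_comm
      _ ≤ ∑ T ∈ (Icc 1 N).powerset, K * if A T ≤ j then w T * 2 ^ (j - A T) else 0 := by
          refine sum_le_sum fun T _ => ?_
          split_ifs with h
          · have e : ∀ p, A T + Nat.clog 2 p ≤ j ↔ Nat.clog 2 p ≤ j - A T := fun p => by omega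
            simp only [e]
            rw [← sum_filter, ← mul_sum]
            nlinarith [mul_le_mul_of_nonneg_left (hK (j - A T)) (hw0 T)]
          · rw [sum_eq_zero fun p _ => if_neg (by omega)]; simp
      _ = _ := by rw [mul_sum]
  have h3 : j * sieveRemainder Ω N j ≤
      (∑ T ∈ (Icc 1 N).powerset, if A T ≤ j then w T * (A T : ℝ) else 0) +
      ∑ T ∈ (Icc 1 N).powerset, if A T ≤ j then w T * 2 ^ (j - A T) else 0 := by
    rw [sieveRemainder_eq_sum, mul_sum, ← sum_add_distrib]
    refine sum_le_sum fun T _ => ?_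
    simp only [hA, hw]
    split_ifs with h
    · have hlt : ((j - A T : ℕ) : ℝ) ≤ 2 ^ (j - A T) := by exact_mod_cast Nat.lt_two_pow_self.le
      have e : (j : ℝ) = A T + (j - A T : ℕ) := by
        exact_mod_cast (Nat.add_sub_cancel' h).symm
      have := mul_le_mul_of_nonneg_left hlt (hw0 T)
      change (j : ℝ) * w T ≤ w T * (A T : ℝ) + w T * 2 ^ (j - A T)
      rw [e]
      linarith
    · simp
  nlinarith [mul_le_mul_of_nonneg_left h1 hK0]

end Remainder

/-! ### Chebyshev bounds on dyadic intervals -/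

section Chebyshev

lemma clog_two_mul_log_two_le {p : ℕ} (hp : 2 ≤ p) :
    (Nat.clog 2 p : ℝ) * Real.log 2 ≤ 2 * Real.log p := by
  have h1 : 2 ^ (Nat.clog 2 p - 1) < p := Nat.pow_pred_clog_lt_self one_lt_two (by omega)
  have h2 : 1 ≤ Nat.clog 2 p := Nat.clog_pos one_lt_two hp
  have h3 : ((Nat.clog 2 p - 1 : ℕ) : ℝ) * Real.log 2 ≤ Real.log p := by
    rw [← Real.log_pow]
    exact Real.log_le_log (by positivity) (by exact_mod_cast h1.le)
  have h4 : Real.log 2 ≤ Real.log p := Real.log_le_log two_pos (by exact_mod_cast hp)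
  push_cast [h2] at h3
  linarith

lemma sum_clog_le {S : Finset ℕ} (hS : ∀ p ∈ S, p.Prime) (i : ℕ) :
    ∑ p ∈ S with Nat.clog 2 p ≤ i, (Nat.clog 2 p : ℝ) ≤ 4 * 2 ^ i := by
  have hl : 0 < Real.log 2 := Real.log_pos one_lt_two
  have h1 : (∑ p ∈ S with Nat.clog 2 p ≤ i, (Nat.clog 2 p : ℝ)) * Real.log 2 ≤
      2 * Chebyshev.theta ((2 ^ i : ℕ) : ℝ) := by
    rw [Chebyshev.theta_eq_sum_primesLE_log, sum_mul, mul_sum]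
    refine (sum_le_sum fun p hp =>
      clog_two_mul_log_two_le (hS p (mem_filter.1 hp).1).two_le).trans ?_
    refine sum_le_sum_of_subset_of_nonneg (fun p hp => ?_) fun p hp _ => ?_
    · obtain ⟨h1, h2⟩ := mem_filter.1 hp
      exact Nat.mem_primesLE.2 ⟨(Nat.clog_le_iff_le_pow one_lt_two).1 h2, hS p h1⟩
    · exact mul_nonneg zero_le_two (Real.log_natCast_nonneg p)
  have h2 := Chebyshev.theta_le_log4_mul_x (x := ((2 ^ i : ℕ) : ℝ)) (by positivity)
  have h3 : Real.log 4 = 2 * Real.log 2 := by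
    rw [show (4 : ℝ) = 2 ^ 2 by norm_num, Real.log_pow]; norm_num
  rw [h3] at h2
  push_cast at h2 h1
  nlinarith

/-- The reciprocals of the primes in a dyadic interval `(2 ^ (i - 1), 2 ^ i]`. -/
lemma mul_sum_clog_eq_inv_le {S : Finset ℕ} (hS : ∀ p ∈ S, p.Prime) (i : ℕ) :
    i * ∑ p ∈ S with Nat.clog 2 p = i, (p : ℝ)⁻¹ ≤ 8 := by
  have h1 := sum_clog_le hS i
  have h2 : (∑ p ∈ S with Nat.clog 2 p = i, (i : ℝ)) ≤ 4 * 2 ^ i := by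
    refine le_trans ?_ h1
    have : (∑ p ∈ S with Nat.clog 2 p = i, (i : ℝ)) =
        ∑ p ∈ S with Nat.clog 2 p = i, (Nat.clog 2 p : ℝ) :=
      sum_congr rfl fun p hp => by rw [(mem_filter.1 hp).2]
    rw [this]
    exact sum_le_sum_of_subset_of_nonneg
      (fun p hp => by simp only [mem_filter] at hp ⊢; exact ⟨hp.1, hp.2.le⟩)
      fun _ _ _ => by positivity
  have h3 : i * ∑ p ∈ S with Nat.clog 2 p = i, (p : ℝ)⁻¹ ≤
      (∑ p ∈ S with Nat.clog 2 p = i, (i : ℝ)) * (2 / 2 ^ i) := by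
    rw [mul_sum, sum_mul]
    refine sum_le_sum fun p hp => ?_
    obtain ⟨hp1, hp2⟩ := mem_filter.1 hp
    have hpp := hS p hp1
    refine mul_le_mul_of_nonneg_left ?_ (by positivity)
    have h1 : 2 ^ (i - 1) < p := by
      rw [← hp2]; exact Nat.pow_pred_clog_lt_self one_lt_two hpp.one_lt
    have h2 : 1 ≤ i := by rw [← hp2]; exact Nat.clog_pos one_lt_two hpp.two_le
    have h4 : (2 : ℝ) ^ i < 2 * p := by
      obtain ⟨i, rfl⟩ := Nat.exists_eq_add_of_le' h2
      rw [Nat.add_sub_cancel] at h1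
      rw [pow_succ, mul_comm]
      have : (2 : ℝ) ^ i < p := by exact_mod_cast h1
      linarith
    have : (0 : ℝ) < p := by exact_mod_cast hpp.pos
    rw [inv_eq_one_div, div_le_div_iff₀ this (by positivity)]
    linarith
  calc _ ≤ _ := h3
    _ ≤ (4 * 2 ^ i) * (2 / 2 ^ i) := by gcongr
    _ = 8 := by field_simp; norm_num

lemma sum_clog_mul_inv_le {S : Finset ℕ} (hS : ∀ p ∈ S, p.Prime) {J : ℕ}
    (hJ : ∀ p ∈ S, Nat.clog 2 p ≤ J) : ∑ p ∈ S, (Nat.clog 2 p : ℝ) * (p : ℝ)⁻¹ ≤ 8 * J := by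
  have hmaps : ∀ p ∈ S, Nat.clog 2 p ∈ Icc 1 J := fun p hp =>
    mem_Icc.2 ⟨Nat.clog_pos one_lt_two (hS p hp).two_le, hJ p hp⟩
  rw [← sum_fiberwise_of_maps_to hmaps]
  calc _ ≤ ∑ i ∈ Icc 1 J, (8 : ℝ) := by
        refine sum_le_sum fun i _ => ?_
        refine le_trans (le_of_eq ?_) (mul_sum_clog_eq_inv_le hS i)
        rw [mul_sum]
        exact sum_congr rfl fun p hp => by rw [(mem_filter.1 hp).2]
    _ = 8 * J := by simp [mul_comm]

end Chebyshev

/-! ### An upper Mertens estimate for primes in a residue class -/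

section Mertens

open ArithmeticFunction.vonMangoldt Complex in
/-- As `x` decreases to `1`, the L-series of the von Mangoldt function on a reduced residue class
modulo `q` exceeds the principal part `φ(q)⁻¹ / (x - 1)` by at most a constant. -/
lemma exists_tsum_residueClass_le {q : ℕ} [NeZero q] {a : ZMod q} (ha : IsUnit a) :
    ∃ C : ℝ, ∀ x ∈ Set.Ioc (1 : ℝ) 2,
      ∑' n, residueClass a n / (n : ℝ) ^ x ≤ (q.totient : ℝ)⁻¹ / (x - 1) + C := by
  have H {x : ℝ} (hx : 1 < x) :
      ∑' n, residueClass a n / (n : ℝ) ^ x =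
        (LFunctionResidueClassAux a x).re + (q.totient : ℝ)⁻¹ / (x - 1) := by
    refine ofReal_injective ?_
    simp only [ofReal_tsum, ofReal_div, ofReal_cpow (Nat.cast_nonneg _), ofReal_natCast,
      ofReal_add, ofReal_inv, ofReal_sub, ofReal_one]
    simp_rw [← LFunctionResidueClassAux_real ha hx,
      eqOn_LFunctionResidueClassAux ha <| Set.mem_ofPred.mpr (ofReal_re x ▸ hx), sub_add_cancel,
      LSeries, LSeries.term]
    refine tsum_congr fun n ↦ ?_
    split_ifs with hn
    · simp only [hn, residueClass_apply_zero, ofReal_zero, zero_div]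
    · rfl
  -- After removal of the pole the function is continuous up to `x = 1`, hence bounded on the
  -- compact interval.
  have hcont : ContinuousOn (fun x : ℝ ↦ (LFunctionResidueClassAux a x).re) (Set.Icc 1 2) :=
    continuous_re.continuousOn.comp (t := Set.univ) (continuousOn_LFunctionResidueClassAux a)
      (fun _ _ ↦ trivial) |>.comp continuous_ofReal.continuousOn fun x hx ↦ by
        simpa only [Set.mem_ofPred_eq, ofReal_re] using hx.1
  obtain ⟨C, hC⟩ := bddAbove_def.mp <| IsCompact.bddAbove_image isCompact_Icc hcont
  refine ⟨C, fun x hx ↦ ?_⟩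
  rw [H hx.1, add_comm, add_le_add_iff_left]
  exact hC _ <| Set.mem_image_of_mem (fun x : ℝ ↦ (LFunctionResidueClassAux a x).re)
    (Set.mem_Icc_of_Ioc hx)

-- All terms of the series are nonnegative, so any finite set of primes in the class is dominated by
-- the whole L-series.
open ArithmeticFunction.vonMangoldt in
lemma exists_sum_log_mul_rpow_le {q : ℕ} [NeZero q] {a : ZMod q} (ha : IsUnit a) :
    ∃ C : ℝ, 0 ≤ C ∧ ∀ S : Finset ℕ, (∀ p ∈ S, p.Prime ∧ (p : ZMod q) = a) →
      ∀ x ∈ Set.Ioc (1 : ℝ) 2,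
        ∑ p ∈ S, Real.log p * (p : ℝ) ^ (-x) ≤ (q.totient : ℝ)⁻¹ / (x - 1) + C := by
  obtain ⟨C, hC⟩ := exists_tsum_residueClass_le ha
  refine ⟨max C 0, le_max_right _ _, fun S hS x hx => ?_⟩
  have hsum : Summable fun n : ℕ => residueClass a n / (n : ℝ) ^ x :=
    LSeries.summable_real_of_abscissaOfAbsConv_lt <|
        (abscissaOfAbsConv_residueClass_le_one a).trans_lt <| mod_cast hx.1
  have h1 : ∑ p ∈ S, Real.log p * (p : ℝ) ^ (-x) = ∑ p ∈ S, residueClass a p / (p : ℝ) ^ x := by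
    refine sum_congr rfl fun p hp => ?_
    obtain ⟨hp1, hp2⟩ := hS p hp
    rw [residueClass, Set.indicator_of_mem (by simpa using hp2),
      ArithmeticFunction.vonMangoldt_apply_prime hp1, Real.rpow_neg (by positivity)]
    rfl
  rw [h1]
  refine (hsum.sum_le_tsum S fun n _ =>
    div_nonneg (residueClass_nonneg a n) (by positivity)).trans ?_
  exact (hC x hx).trans (by gcongr; exact le_max_left _ _)

lemma sum_inv_sq_le_two {S : Finset ℕ} (hS : ∀ p ∈ S, 1 ≤ p) : ∑ p ∈ S, ((p : ℝ) ^ 2)⁻¹ ≤ 2 := by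
  refine le_trans ?_ (le_trans (sum_Ioo_inv_sq_le (α := ℝ) 0 (S.sup id + 1)) (by norm_num))
  refine sum_le_sum_of_subset_of_nonneg (fun p hp => ?_) fun _ _ _ => by positivity
  have := Finset.le_sup (f := id) hp
  simp only [mem_Ioo, id] at *
  exact ⟨hS p hp, by omega⟩

/-- The primes of a reduced residue class modulo `q` have logarithmic dimension at most
`1 / φ(q)`. -/
theorem exists_sum_inv_prime_le {q : ℕ} [NeZero q] {a : ZMod q} (ha : IsUnit a) :
    ∃ C : ℝ, ∀ (J : ℕ) (S : Finset ℕ), 1 ≤ J →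
      (∀ p ∈ S, p.Prime ∧ (p : ZMod q) = a ∧ p ≤ 2 ^ J) →
        ∑ p ∈ S, (p : ℝ)⁻¹ ≤ Real.log J / q.totient + C := by
  obtain ⟨C, hC0, hC⟩ := exists_sum_log_mul_rpow_le ha
  refine ⟨2 + C + 8, fun J S hJ hS => ?_⟩
  have hJ' : (1 : ℝ) ≤ J := by exact_mod_cast hJ
  -- At this distance from `1` the sums of `p ^ (-s)` and of `1 / p` over `p ≤ 2 ^ J` differ by a
  -- bounded amount.
  set s : ℝ := 1 + 1 / J with hs
  have hs1 : 1 < s := by rw [hs]; have : (0 : ℝ) < 1 / J := by positivity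
                         linarith
  have hs2 : s ≤ 2 := by
    have : 1 / (J : ℝ) ≤ 1 := (div_le_one (by positivity)).2 hJ'
    rw [hs]; linarith
  have hSpos : ∀ p ∈ S, (0 : ℝ) < p := fun p hp => by exact_mod_cast (hS p hp).1.pos
  set c : ℝ := (q.totient : ℝ)⁻¹ with hc
  -- The bound `hC` says precisely that `G` has nonnegative derivative; comparing `G s` with `G 2`
  -- integrates it.
  let G : ℝ → ℝ := fun x => ∑ p ∈ S, (p : ℝ) ^ (-x) + (c * Real.log (x - 1) + C * x)
  have hder : ∀ x, 1 < x → HasDerivAt G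
      (∑ p ∈ S, (Real.log p * (-1) * (p : ℝ) ^ (-x)) + (c * (1 / (x - 1)) + C * 1)) x := by
    intro x hx
    refine HasDerivAt.add (HasDerivAt.fun_sum fun p hp => ?_) (HasDerivAt.add ?_ ?_)
    · exact (hasDerivAt_neg x).const_rpow (hSpos p hp)
    · exact (((hasDerivAt_id x).sub_const 1).log (by simp; linarith)).const_mul c
    · exact (hasDerivAt_id x).const_mul C
  have hmono : MonotoneOn G (Set.Icc s 2) := by
    refine monotoneOn_of_deriv_nonneg (convex_Icc s 2)
      (fun x hx => (hder x (hs1.trans_le hx.1)).continuousAt.continuousWithinAt)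
      (fun x hx => ?_) fun x hx => ?_ <;> rw [interior_Icc] at hx
    · exact (hder x (hs1.trans hx.1)).differentiableAt.differentiableWithinAt
    · rw [(hder x (hs1.trans hx.1)).deriv]
      have := hC S (fun p hp => ⟨(hS p hp).1, (hS p hp).2.1⟩) x ⟨hs1.trans hx.1, hx.2.le⟩
      have e : ∑ p ∈ S, (Real.log p * (-1) * (p : ℝ) ^ (-x)) =
          - ∑ p ∈ S, Real.log p * (p : ℝ) ^ (-x) := by
        rw [← sum_neg_distrib]; exact sum_congr rfl fun _ _ => by ring
      rw [e, mul_one_div, mul_one]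
      linarith
  have hG := hmono ⟨le_rfl, hs2⟩ ⟨hs2, le_rfl⟩ hs2
  have hsq : ∑ p ∈ S, (p : ℝ) ^ (-2 : ℝ) ≤ 2 := by
    refine le_trans (le_of_eq (sum_congr rfl fun p hp => ?_))
      (sum_inv_sq_le_two fun p hp => (hS p hp).1.pos)
    rw [Real.rpow_neg (by positivity)]
    norm_num
  have hlog : Real.log (s - 1) = - Real.log J := by
    rw [hs, add_sub_cancel_left, one_div, Real.log_inv]
  have h21 : Real.log (2 - 1) = 0 := by norm_num
  simp only [G, hlog, h21] at hG
  -- By `exp (-u) ≥ 1 - u` the difference is at most the sum of `log p / p` divided by `J`, which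
  -- the dyadic Chebyshev bound controls.
  have hdiff : ∑ p ∈ S, (p : ℝ)⁻¹ - ∑ p ∈ S, (p : ℝ) ^ (-s) ≤ 8 := by
    have h8 := sum_clog_mul_inv_le (S := S) (fun p hp => (hS p hp).1) (J := J)
      fun p hp => (Nat.clog_le_iff_le_pow one_lt_two).2 (hS p hp).2.2
    rw [← sum_sub_distrib]
    have : ∑ p ∈ S, ((p : ℝ)⁻¹ - (p : ℝ) ^ (-s)) ≤
        (1 / J) * ∑ p ∈ S, (Nat.clog 2 p : ℝ) * (p : ℝ)⁻¹ := by
      rw [mul_sum]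
      refine sum_le_sum fun p hp => ?_
      have hp0 := hSpos p hp
      have e1 : (p : ℝ) ^ (-s) = (p : ℝ)⁻¹ * Real.exp (-(1 / J * Real.log p)) := by
        rw [hs, neg_add, Real.rpow_add hp0, Real.rpow_neg_one, Real.rpow_def_of_pos hp0]
        ring_nf
      have e2 := Real.add_one_le_exp (-(1 / J * Real.log p))
      have e3 : Real.log p ≤ Nat.clog 2 p := by
        have : (p : ℝ) ≤ 2 ^ Nat.clog 2 p := by exact_mod_cast Nat.le_pow_clog one_lt_two p
        have h1 := Real.log_le_log hp0 this
        rw [Real.log_pow] at h1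
        have h2 : Real.log 2 ≤ 1 := by linarith [Real.log_two_lt_d9]
        nlinarith [(Nat.cast_nonneg (Nat.clog 2 p) : (0 : ℝ) ≤ _)]
      have e4 : 1 / J * Real.log p ≤ 1 / J * (Nat.clog 2 p : ℝ) := by gcongr
      have hpi : 0 ≤ (p : ℝ)⁻¹ := by positivity
      rw [e1]
      nlinarith [mul_le_mul_of_nonneg_left e2 hpi, mul_le_mul_of_nonneg_left e4 hpi]
    refine this.trans ?_
    calc _ ≤ 1 / (J : ℝ) * (8 * J) := by gcongr
      _ = 8 := by field_simp
  have hdiv : Real.log J / q.totient = c * Real.log J := by rw [hc]; ring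
  rw [hdiv]
  nlinarith

end Mertens

/-! ### The fundamental lemma -/

section FundamentalLemma

variable {β : ℕ} {h Λ : ℕ → ℝ}

lemma one_add_mul_exp_le {x y : ℝ} (hx0 : 0 ≤ x) (hx1 : x ≤ 1 / 2) (hy : y ≤ 1) :
    1 + x * Real.exp y ≤ (1 - x) * Real.exp (5 * x) := by
  have h1 : Real.exp y ≤ 3 :=
    (Real.exp_le_exp.2 hy).trans (by linarith [Real.exp_one_lt_d9])
  have h2 := Real.quadratic_le_exp_of_nonneg (by linarith : 0 ≤ 5 * x)
  have h3 := mul_le_mul_of_nonneg_left h2 (by linarith : 0 ≤ 1 - x)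
  have h4 := mul_le_mul_of_nonneg_left h1 hx0
  nlinarith [mul_nonneg (mul_nonneg hx0 hx0) (by linarith : 0 ≤ 1 / 2 - x)]

/-- One step of the sieve dissipates the exponential error if its rate drops by enough. -/
lemma exp_step_le {b x a l l' j : ℝ} (hx0 : 0 ≤ x) (hx1 : x ≤ 1 / 2) (hla : l * a ≤ 1)
    (hl : 5 * x ≤ (l - l') * j) :
    Real.exp (b - l * j) + x * Real.exp (b - l * (j - a)) ≤ (1 - x) * Real.exp (b - l' * j) := by
  have e1 : Real.exp (b - l * (j - a)) = Real.exp (b - l * j) * Real.exp (l * a) := by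
    rw [← Real.exp_add]; ring_nf
  have e2 : Real.exp (b - l' * j) = Real.exp (b - l * j) * Real.exp ((l - l') * j) := by
    rw [← Real.exp_add]; ring_nf
  have h1 := one_add_mul_exp_le hx0 hx1 hla
  have h2 := mul_le_mul_of_nonneg_left (Real.exp_le_exp.2 hl) (by linarith : 0 ≤ 1 - x)
  have h3 := mul_le_mul_of_nonneg_left (h1.trans h2) (Real.exp_pos (b - l * j)).le
  rw [e1, e2]
  linarith

/-- Induction on the sifting limit: the relative error stays below `exp (β - Λ m * j)`, and the drop
of the rate from `Λ m` to `Λ (m + 1)` pays for the new density `h (m + 1)`. Where the lower sieve is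
truncated to zero the exponential is at least `1`, so the lower bound in fact holds at every level.
-/
lemma sieve_exp_bounds (hβ : 2 ≤ β) (h0 : ∀ m, 0 ≤ h m) (h1 : ∀ m, h m ≤ 1 / 2) {N : ℕ}
    (hΛ0 : ∀ m, 0 ≤ Λ m) (hΛ1 : ∀ m < N, Λ m * Nat.clog 2 (m + 1) ≤ 1)
    (hΛ2 : ∀ m < N, 5 * h (m + 1) ≤ (Λ m - Λ (m + 1)) * (((β - 1) * Nat.clog 2 (m + 1) : ℕ) : ℝ))
    (hΛ3 : ∀ m < N, Λ (m + 1) ≤ Λ m) (m : ℕ) (hm : m ≤ N) :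
    ∀ j : ℕ, ((β - 1) * Nat.clog 2 m ≤ j →
        upperSieve β h m j ≤ siftedDensity h m * (1 + Real.exp (β - Λ m * j))) ∧
      (β * Nat.clog 2 m ≤ j →
        siftedDensity h m * (1 - Real.exp (β - Λ m * j)) ≤ lowerSieve β h m j) := by
  have h1' : ∀ m, h m ≤ 1 := fun m => (h1 m).trans (by norm_num)
  induction m with
  | zero =>
    intro j
    have := (Real.exp_pos (β - Λ 0 * j)).le
    simp [siftedDensity, this]
  | succ m ih =>
    intro j
    have ih := ih (by omega)
    set a := Nat.clog 2 (m + 1) with ha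
    have hmono : Nat.clog 2 m ≤ a := Nat.clog_mono_right 2 (by omega)
    have hV := siftedDensity_nonneg h1' m
    have hp0 := h0 (m + 1)
    have hp1 := h1 (m + 1)
    have hla := hΛ1 m (by omega)
    have hβa : a ≤ (β - 1) * a := Nat.le_mul_of_pos_left a (by omega)
    have hβa' : (β - 1) * a + a = β * a := by
      obtain ⟨b, rfl⟩ := Nat.exists_eq_add_of_le hβ
      rw [show 2 + b - 1 = b + 1 by omega]; ring
    have key : (β - 1) * a ≤ j → 
        Real.exp (β - Λ m * j) + h (m + 1) * Real.exp (β - Λ m * ((j : ℝ) - a)) ≤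
          (1 - h (m + 1)) * Real.exp (β - Λ (m + 1) * j) := fun hj => by
      refine exp_step_le hp0 hp1 hla ((hΛ2 m (by omega)).trans ?_)
      exact mul_le_mul_of_nonneg_left (by exact_mod_cast hj) (by linarith [hΛ3 m (by omega)])
    have hlow : ∀ i : ℕ, siftedDensity h m * (1 - Real.exp (β - Λ m * i)) ≤ lowerSieve β h m i := by
      intro i
      by_cases hi : β * Nat.clog 2 m ≤ i
      · exact (ih i).2 hi
      · rw [lowerSieve_eq_zero _ _ (by omega)]
        refine mul_nonpos_of_nonneg_of_nonpos hV (sub_nonpos.2 (Real.one_le_exp ?_))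
        have e1 : (i : ℝ) ≤ β * a := by
          exact_mod_cast (by omega : i ≤ β * Nat.clog 2 m).trans (Nat.mul_le_mul_left β hmono)
        have e2 := mul_le_mul_of_nonneg_left e1 (hΛ0 m)
        nlinarith [(Nat.cast_nonneg β : (0 : ℝ) ≤ β)]
    rw [siftedDensity_succ]
    constructor
    · intro hj
      have hja : a ≤ j := hβa.trans hj
      have hc : ((j - a : ℕ) : ℝ) = (j : ℝ) - a := by push_cast [hja]; ring
      rw [upperSieve_succ, if_neg (by omega), ← ha]
      have e1 := (ih j).1 ((Nat.mul_le_mul_left _ hmono).trans hj)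
      have e2 := mul_le_mul_of_nonneg_left (hlow (j - a)) hp0
      rw [hc] at e2
      nlinarith [mul_le_mul_of_nonneg_left (key hj) hV]
    · intro hj
      have hja : a ≤ j := by omega
      have hc : ((j - a : ℕ) : ℝ) = (j : ℝ) - a := by push_cast [hja]; ring
      rw [lowerSieve_succ, if_neg (by rw [← ha]; omega), ← ha]
      have e1 := (ih j).2 ((Nat.mul_le_mul_left _ hmono).trans hj)
      have e2 := mul_le_mul_of_nonneg_left ((ih (j - a)).1
        ((Nat.mul_le_mul_left _ hmono).trans (by omega))) hp0
      rw [hc] at e2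
      nlinarith [mul_le_mul_of_nonneg_left (key (by omega)) hV]

/-- The tail of the densities weighted by the inverse size, for densities of bounded dimension. -/
lemma clog_mul_sum_div_clog_le {c : ℝ} (hc : 0 ≤ c) {N : ℕ} (h0 : ∀ m, 0 ≤ h m)
    (hmass : ∀ i : ℕ, i * ∑ p ∈ Icc 1 N with Nat.clog 2 p = i, h p ≤ c) (m : ℕ) :
    Nat.clog 2 (m + 1) * ∑ l ∈ Ioc m N, h l / Nat.clog 2 l ≤ 2 * c := by
  set a := Nat.clog 2 (m + 1) with ha
  rcases Nat.eq_zero_or_pos a with h0a | hapos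
  · rw [h0a]; simp [hc]
  have hmaps : ∀ l ∈ Ioc m N, Nat.clog 2 l ∈ Ioo (a - 1) (Nat.clog 2 N + 1) := fun l hl => by
    have hl := mem_Ioc.1 hl
    have e1 : a ≤ Nat.clog 2 l := Nat.clog_mono_right 2 hl.1
    have e2 : Nat.clog 2 l ≤ Nat.clog 2 N := Nat.clog_mono_right 2 hl.2
    exact mem_Ioo.2 ⟨by omega, by omega⟩
  rw [← sum_fiberwise_of_maps_to hmaps]
  have h2 : ∑ i ∈ Ioo (a - 1) (Nat.clog 2 N + 1), ∑ l ∈ Ioc m N with Nat.clog 2 l = i,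
      h l / Nat.clog 2 l ≤ ∑ i ∈ Ioo (a - 1) (Nat.clog 2 N + 1), c * ((i : ℝ) ^ 2)⁻¹ := by
    refine sum_le_sum fun i hi => ?_
    have hi0 : (0 : ℝ) < i := by exact_mod_cast (by have := mem_Ioo.1 hi; omega : 0 < i)
    have e : ∑ l ∈ Ioc m N with Nat.clog 2 l = i, h l / Nat.clog 2 l ≤
        (∑ p ∈ Icc 1 N with Nat.clog 2 p = i, h p) / i := by
      rw [sum_div]
      refine le_trans (le_of_eq (sum_congr rfl fun l hl => by rw [(mem_filter.1 hl).2]))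
        (sum_le_sum_of_subset_of_nonneg (fun l hl => ?_)
          fun l _ _ => div_nonneg (h0 l) (by positivity))
      simp only [mem_filter, mem_Ioc, mem_Icc] at hl ⊢
      omega
    refine e.trans ?_
    have := hmass i
    rw [← div_eq_mul_inv, div_le_div_iff₀ hi0 (by positivity)]
    nlinarith
  have h3 := sum_Ioo_inv_sq_le (α := ℝ) (a - 1) (Nat.clog 2 N + 1)
  rw [← mul_sum] at h2
  have ha' : (0 : ℝ) < a := by exact_mod_cast hapos
  have e : ((a - 1 : ℕ) : ℝ) + 1 = a := by exact_mod_cast Nat.sub_add_cancel hapos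
  rw [e] at h3
  calc _ ≤ (a : ℝ) * (c * (2 / a)) :=
        mul_le_mul_of_nonneg_left (h2.trans (mul_le_mul_of_nonneg_left h3 hc)) ha'.le
    _ = 2 * c := by field_simp

/-- The fundamental lemma of the sieve, in bounded dimension. -/
theorem fundamental_lemma (hβ2 : 2 ≤ β) (h0 : ∀ m, 0 ≤ h m) (h1 : ∀ m, h m ≤ 1 / 2)
    (hone : h 1 = 0) {c : ℝ} (hc : 0 ≤ c) (hβ : 20 * c + 1 ≤ β) {B j : ℕ} (hB : 0 < B)
    (hmass : ∀ i : ℕ, i * ∑ p ∈ Icc 1 (2 ^ B) with Nat.clog 2 p = i, h p ≤ c)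
    (hj : (2 * β + 2) * B ≤ j) :
    upperSieve β h (2 ^ B) j ≤ 2 * siftedDensity h (2 ^ B) ∧
      siftedDensity h (2 ^ B) / 2 ≤ lowerSieve β h (2 ^ B) j := by
  set N := 2 ^ B with hN
  have hcl : Nat.clog 2 N = B := Nat.clog_pow _ _ one_lt_two
  have hB' : (0 : ℝ) < B := by exact_mod_cast hB
  -- The final rate `1 / (2 * B)` makes the error at most `exp (-1)` at level `(2 * β + 2) * B`. It
  -- uses up half of the allowance `Λ m * clog 2 (m + 1) ≤ 1`; the tail sum fits into the other half
  -- because `20 * c + 1 ≤ β`.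
  set Λ : ℕ → ℝ := fun m => 1 / (2 * B) + 5 / (β - 1) * ∑ l ∈ Ioc m N, h l / Nat.clog 2 l with hΛ
  have hb1 : (0 : ℝ) < (β : ℝ) - 1 := by
    have : (2 : ℝ) ≤ β := by exact_mod_cast hβ2
    linarith
  have hsum0 : ∀ m, 0 ≤ ∑ l ∈ Ioc m N, h l / Nat.clog 2 l := fun m =>
    sum_nonneg fun l _ => div_nonneg (h0 l) (by positivity)
  have hΛ0 : ∀ m, 0 ≤ Λ m := fun m => by have := hsum0 m; simp only [hΛ]; positivity
  have hΛ1 : ∀ m < N, Λ m * Nat.clog 2 (m + 1) ≤ 1 := fun m hm => by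
    have e1 := clog_mul_sum_div_clog_le hc h0 hmass m
    have e2 : (Nat.clog 2 (m + 1) : ℝ) ≤ B := by
      rw [← hcl]; exact_mod_cast Nat.clog_mono_right 2 hm
    have e3 : 1 / (2 * B) * (Nat.clog 2 (m + 1) : ℝ) ≤ 1 / 2 := by
      rw [div_mul_eq_mul_div, div_le_div_iff₀ (by positivity) two_pos]; linarith
    have e4 : 5 / ((β : ℝ) - 1) * (2 * c) ≤ 1 / 2 := by
      rw [div_mul_eq_mul_div, div_le_div_iff₀ hb1 two_pos]; linarith
    have e5 : 0 ≤ 5 / ((β : ℝ) - 1) := by positivity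
    simp only [hΛ]
    nlinarith [mul_le_mul_of_nonneg_left e1 e5]
  have hstep : ∀ m < N, Λ m - Λ (m + 1) =
      5 / (β - 1) * (h (m + 1) / Nat.clog 2 (m + 1)) := fun m hm => by
    simp only [hΛ]
    rw [← insert_Ioc_add_one_left_eq_Ioc hm, sum_insert (by simp)]
    ring
  have hΛ3 : ∀ m < N, Λ (m + 1) ≤ Λ m := fun m hm => by
    have := hstep m hm
    have e : 0 ≤ 5 / ((β : ℝ) - 1) * (h (m + 1) / Nat.clog 2 (m + 1)) := by
      have := h0 (m + 1); positivity
    linarith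
  have hΛ2 : ∀ m < N, 5 * h (m + 1) ≤
      (Λ m - Λ (m + 1)) * (((β - 1) * Nat.clog 2 (m + 1) : ℕ) : ℝ) := fun m hm => by
    rw [hstep m hm]
    rcases Nat.eq_zero_or_pos m with rfl | hmpos
    · simp [hone]
    · have : (0 : ℝ) < Nat.clog 2 (m + 1) := by
        exact_mod_cast Nat.clog_pos one_lt_two (by omega)
      have e : ((β - 1 : ℕ) : ℝ) = β - 1 := by push_cast [show 1 ≤ β by omega]; ring
      push_cast
      rw [e]
      refine le_of_eq ?_
      field_simp
  have key := sieve_exp_bounds hβ2 h0 h1 hΛ0 hΛ1 hΛ2 hΛ3 N le_rfl j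
  rw [hcl] at key
  have hV := siftedDensity_nonneg (fun m => (h1 m).trans (by norm_num)) N
  have hj' : (2 * (β : ℝ) + 2) * B ≤ j := by exact_mod_cast hj
  have hexp : Real.exp (β - Λ N * j) ≤ 1 / 2 := by
    have e1 : Λ N = 1 / (2 * B) := by simp [hΛ]
    have e2 : (β : ℝ) + 1 ≤ Λ N * j := by
      rw [e1, div_mul_eq_mul_div, le_div_iff₀ (by positivity)]; linarith
    have e3 : Real.exp (β - Λ N * j) ≤ Real.exp (-1) := Real.exp_le_exp.2 (by linarith)
    have e4 : Real.exp (-1) ≤ 1 / 2 := by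
      rw [Real.exp_neg, inv_eq_one_div]
      exact one_div_le_one_div_of_le two_pos (by linarith [Real.exp_one_gt_d9])
    linarith
  constructor
  · have := key.1 (le_trans (Nat.mul_le_mul_right B (by omega)) hj)
    nlinarith
  · have := key.2 (le_trans (Nat.mul_le_mul_right B (by omega)) hj)
    nlinarith

end FundamentalLemma

/-! ### Reduction of the polynomial to linear forms -/

/-- The primitive integral linear form with the root `r`. -/
def linForm (r : ℚ) (n : ℤ) : ℤ := r.den * n - r.num

section Polynomial

open Polynomial

/-- The values of a primitive polynomial that splits over `ℚ` divide the products of the values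
of the linear forms of its roots. -/
lemma eval_dvd_prod_linForm {f : ℤ[X]} (hf : f.IsPrimitive)
    (hs : (f.map (Int.castRingHom ℚ)).Splits) (n : ℤ) :
    f.eval n ∣ ((f.map (Int.castRingHom ℚ)).roots.map fun r => linForm r n).prod := by
  set R := (f.map (Int.castRingHom ℚ)).roots with hR
  set G : ℤ[X] := (R.map fun r => (C (r.den : ℤ) * X - C r.num : ℤ[X])).prod with hG
  have hmap : G.map (Int.castRingHom ℚ) =
      (R.map fun r => (C (r.den : ℚ))).prod * (R.map fun r => X - C r).prod := by
    rw [hG, Polynomial.map_multiset_prod, Multiset.map_map, ← Multiset.prod_map_mul]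
    congr 1
    refine Multiset.map_congr rfl fun r _ => ?_
    have e : C (r.den : ℚ) * C r = C (r.num : ℚ) := by
      rw [← C_mul, Rat.den_mul_eq_num]
    simp only [Function.comp_apply, Polynomial.map_sub, Polynomial.map_mul, map_C, map_X, mul_sub, e]
    simp
  -- By Gauss's lemma divisibility may be tested over `ℚ`, where the leading coefficient is a unit.
  have hdvd : f ∣ G := by
    rw [IsPrimitive.Int.dvd_iff_map_cast_dvd_map_cast _ _ hf, hmap]
    refine Dvd.dvd.mul_left ?_ _
    have hlead : (f.map (Int.castRingHom ℚ)).leadingCoeff ≠ 0 := by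
      rw [leadingCoeff_ne_zero, Polynomial.map_ne_zero_iff (RingHom.injective_int _)]
      exact hf.ne_zero
    conv_lhs => rw [hs.eq_prod_roots]
    exact (isUnit_C.2 hlead.isUnit).mul_left_dvd.2 dvd_rfl
  obtain ⟨H, hH⟩ := hdvd
  refine ⟨H.eval n, ?_⟩
  rw [← eval_mul, ← hH, hG, ← coe_evalRingHom, map_multiset_prod, Multiset.map_map]
  congr 1
  refine Multiset.map_congr rfl fun r _ => ?_
  simp [linForm]

lemma exists_dvd_linForm_of_dvd_eval {f : ℤ[X]} (hf : f.IsPrimitive)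
    (hs : (f.map (Int.castRingHom ℚ)).Splits) {p : ℕ} (hp : p.Prime) {n : ℤ}
    (h : (p : ℤ) ∣ f.eval n) :
    ∃ r ∈ (f.map (Int.castRingHom ℚ)).roots, (p : ℤ) ∣ linForm r n := by
  have := h.trans (eval_dvd_prod_linForm hf hs n)
  obtain ⟨a, ha, hpa⟩ := (Nat.prime_iff_prime_int.1 hp).exists_mem_multiset_dvd this
  obtain ⟨r, hr, rfl⟩ := Multiset.mem_map.1 ha
  exact ⟨r, hr, hpa⟩

end Polynomial

lemma linForm_sub (r : ℚ) (m n : ℤ) : linForm r m - linForm r n = r.den * (m - n) := by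
  unfold linForm; ring

lemma not_dvd_den_of_dvd_linForm {p : ℕ} (hp : p.Prime) {r : ℚ} {n : ℤ}
    (h : (p : ℤ) ∣ linForm r n) : ¬ p ∣ r.den := by
  intro hd
  have h1 : (p : ℤ) ∣ r.num := by
    have : r.num = r.den * n - linForm r n := by unfold linForm; ring
    rw [this]
    exact dvd_sub (Dvd.dvd.mul_right (by exact_mod_cast hd) _) h
  have h2 : p ∣ r.num.natAbs := Int.natCast_dvd.1 h1
  have := Nat.dvd_gcd h2 hd
  rw [r.reduced] at this
  exact hp.one_lt.ne' (Nat.dvd_one.1 this)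

/-- Few linear forms cannot all take values divisible by a large prime power. -/
lemma exists_not_pow_dvd_linForm {R : Finset ℚ} {k ℓ B : ℕ} (hR : #R ≤ k) (hℓ : ℓ.Prime)
    (hB : k < ℓ ^ B) : ∃ n ≤ k, ∀ r ∈ R, ¬ ((ℓ ^ B : ℕ) : ℤ) ∣ linForm r n := by
  by_contra! hcon
  choose! g hg1 hg2 using hcon
  -- Pigeonhole: there are more points than forms, so a single form is divisible at two points whose
  -- distance is at most `k < ℓ ^ B`.
  obtain ⟨m, hm, n, hn, hne, he⟩ := exists_ne_map_eq_of_card_lt_of_maps_to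
    (s := range (k + 1)) (t := R) (f := g) (by simpa using Nat.lt_succ_of_le hR)
    (fun n hn => hg1 n (by have := mem_range.1 hn; omega))
  have hm := mem_range.1 hm
  have hn := mem_range.1 hn
  have d1 := hg2 m (by omega)
  have d2 := hg2 n (by omega)
  rw [← he] at d2
  have hB0 : B ≠ 0 := by
    rintro rfl
    simp only [pow_zero] at hB
    omega
  have hden := not_dvd_den_of_dvd_linForm hℓ
    ((Int.natCast_dvd_natCast.2 (dvd_pow_self ℓ hB0)).trans d1)
  have d3 := dvd_sub d1 d2
  rw [linForm_sub] at d3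
  have hcop : IsCoprime ((ℓ ^ B : ℕ) : ℤ) ((g m).den : ℤ) :=
    Nat.isCoprime_iff_coprime.2 (Nat.Coprime.pow_left B ((Nat.Prime.coprime_iff_not_dvd hℓ).2 hden))
  have d4 := hcop.dvd_of_dvd_mul_left d3
  have := Int.eq_zero_of_abs_lt_dvd d4 (by rw [abs_lt]; constructor <;> omega)
  omega

/-! ### The sifting problem attached to linear forms -/

/-- The residues `s` modulo `p` for which some linear form vanishes at `W * s + n₀`, for the
primes `p` in `P`. -/
noncomputable def formResidues (P : Set ℕ) (R : Finset ℚ) (W n₀ : ℕ) (p : ℕ) : Finset ℕ :=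
  open Classical in
  if p ∈ P then (range p).filter fun s => ∃ r ∈ R, (p : ℤ) ∣ linForm r (W * s + n₀) else ∅

section FormResidues

variable {P : Set ℕ} {R : Finset ℚ} {W n₀ : ℕ}

lemma lt_of_mem_formResidues (p ω : ℕ) (h : ω ∈ formResidues P R W n₀ p) : ω < p := by
  unfold formResidues at h
  split_ifs at h
  · exact mem_range.1 (mem_filter.1 h).1
  · simp at h

lemma mem_of_formResidues_nonempty {p : ℕ} (h : (formResidues P R W n₀ p).Nonempty) : p ∈ P := by
  by_contra hp
  simp [formResidues, hp] at h

lemma formResidues_eq_empty {p : ℕ} (hp : p ∉ P) : formResidues P R W n₀ p = ∅ := by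
  simp [formResidues, hp]

lemma mod_mem_formResidues_iff {p t : ℕ} (hp : p ∈ P) (hp0 : 0 < p) :
    t % p ∈ formResidues P R W n₀ p ↔ ∃ r ∈ R, (p : ℤ) ∣ linForm r ((W * t + n₀ : ℕ) : ℤ) := by
  rw [formResidues, if_pos hp, mem_filter, mem_range]
  simp only [Nat.mod_lt t hp0, true_and]
  have : ∀ r, (p : ℤ) ∣ linForm r (W * (t % p : ℕ) + n₀) ↔
      (p : ℤ) ∣ linForm r ((W * t + n₀ : ℕ) : ℤ) := fun r => by
    refine (dvd_iff_dvd_of_dvd_sub ?_).symm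
    rw [linForm_sub]
    have e : (t : ℤ) = p * (t / p : ℕ) + (t % p : ℕ) := by
      exact_mod_cast (Nat.div_add_mod t p).symm
    refine ⟨r.den * W * (t / p : ℕ), ?_⟩
    push_cast at e ⊢
    linear_combination (r.den * W : ℤ) * e
  simp only [this]

/-- Each form contributes at most one residue, since `p` divides neither `W` nor the denominator of
a form that vanishes modulo `p`. -/
lemma card_formResidues_le (hP : ∀ p ∈ P, p.Prime ∧ ¬ p ∣ W) (p : ℕ) :
    #(formResidues P R W n₀ p) ≤ #R := by
  classical
  by_cases hp : p ∈ P
  swap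
  · simp [formResidues_eq_empty hp]
  obtain ⟨hpp, hpW⟩ := hP p hp
  have : formResidues P R W n₀ p ⊆
      R.biUnion fun r => (range p).filter fun s => (p : ℤ) ∣ linForm r (W * (s : ℕ) + n₀) := by
    intro s hs
    rw [formResidues, if_pos hp, mem_filter] at hs
    obtain ⟨r, hr, hd⟩ := hs.2
    exact mem_biUnion.2 ⟨r, hr, mem_filter.2 ⟨hs.1, hd⟩⟩
  refine (card_le_card this).trans (card_biUnion_le.trans ?_)
  rw [card_eq_sum_ones]
  refine sum_le_sum fun r _ => card_le_one.2 fun s hs s' hs' => ?_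
  obtain ⟨h1, h2⟩ := mem_filter.1 hs
  obtain ⟨h1', h2'⟩ := mem_filter.1 hs'
  have h1 := mem_range.1 h1
  have h1' := mem_range.1 h1'
  have hd := dvd_sub h2 h2'
  rw [linForm_sub] at hd
  have hden := not_dvd_den_of_dvd_linForm hpp h2
  have hpi := Nat.prime_iff_prime_int.1 hpp
  have e : ((r.den : ℤ)) * ((W * s + n₀) - (W * s' + n₀)) = r.den * (W * (s - s')) := by ring
  rw [e] at hd
  have d1 := (hpi.dvd_or_dvd hd).resolve_left (by exact_mod_cast hden)
  have d2 := (hpi.dvd_or_dvd d1).resolve_left (by exact_mod_cast hpW)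
  have := Int.eq_zero_of_abs_lt_dvd d2 (by rw [abs_lt]; constructor <;> omega)
  omega

lemma coprime_of_formResidues_nonempty (hP : ∀ p ∈ P, p.Prime ∧ ¬ p ∣ W) (p q : ℕ) (hpq : p ≠ q)
    (hp : (formResidues P R W n₀ p).Nonempty) (hq : (formResidues P R W n₀ q).Nonempty) :
    Nat.Coprime p q :=
  (Nat.coprime_primes (hP p (mem_of_formResidues_nonempty hp)).1
    (hP q (mem_of_formResidues_nonempty hq)).1).2 hpq

lemma residueDensity_formResidues_le (hP : ∀ p ∈ P, p.Prime ∧ ¬ p ∣ W) (p : ℕ) :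
    residueDensity (formResidues P R W n₀) p ≤ #R * (p : ℝ)⁻¹ := by
  rw [residueDensity, div_eq_mul_inv]
  gcongr
  exact card_formResidues_le hP p

lemma residueDensity_formResidues_eq_zero {p : ℕ} (hp : p ∉ P) :
    residueDensity (formResidues P R W n₀) p = 0 := by
  simp [residueDensity, formResidues_eq_empty hp]

lemma residueDensity_formResidues_le_half (hP : ∀ p ∈ P, p.Prime ∧ ¬ p ∣ W)
    (hP2 : ∀ p ∈ P, 2 * #R ≤ p) (p : ℕ) :
    residueDensity (formResidues P R W n₀) p ≤ 1 / 2 := by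
  by_cases hp : p ∈ P
  · refine (residueDensity_formResidues_le hP p).trans ?_
    have h1 : (0 : ℝ) < p := by exact_mod_cast (hP p hp).1.pos
    have h2 : 2 * (#R : ℝ) ≤ p := by exact_mod_cast hP2 p hp
    rw [← div_eq_mul_inv, div_le_div_iff₀ h1 two_pos]
    linarith
  · rw [residueDensity_formResidues_eq_zero hp]; norm_num

open Classical in
lemma sum_residueDensity_eq_sum_filter (S : Finset ℕ) (w : ℕ → ℝ) :
    ∑ p ∈ S, residueDensity (formResidues P R W n₀) p * w p =
      ∑ p ∈ S with p ∈ P, residueDensity (formResidues P R W n₀) p * w p := by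
  rw [sum_filter]
  refine sum_congr rfl fun p _ => ?_
  split_ifs with h
  · rfl
  · rw [residueDensity_formResidues_eq_zero h, zero_mul]

lemma sum_residueDensity_le (hP : ∀ p ∈ P, p.Prime ∧ ¬ p ∣ W) {S T : Finset ℕ}
    (hST : ∀ p ∈ S, p ∈ P → p ∈ T) :
    ∑ p ∈ S, residueDensity (formResidues P R W n₀) p ≤ #R * ∑ p ∈ T, (p : ℝ)⁻¹ := by
  classical
  have e := sum_residueDensity_eq_sum_filter (P := P) (R := R) (W := W) (n₀ := n₀) S (fun _ => 1)
  simp only [mul_one] at e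
  rw [e, mul_sum]
  refine (sum_le_sum fun p _ => residueDensity_formResidues_le hP p).trans ?_
  refine sum_le_sum_of_subset_of_nonneg (fun p hp => ?_) fun _ _ _ => by positivity
  exact hST p (mem_filter.1 hp).1 (mem_filter.1 hp).2

lemma clog_mass_formResidues_le (hP : ∀ p ∈ P, p.Prime ∧ ¬ p ∣ W) (N i : ℕ) :
    i * ∑ p ∈ Icc 1 N with Nat.clog 2 p = i, residueDensity (formResidues P R W n₀) p ≤
      8 * #R := by
  classical
  set T := (Icc 1 N).filter (· ∈ P)
  have hT : ∀ p ∈ T, p.Prime := fun p hp => (hP p (mem_filter.1 hp).2).1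
  have h1 := mul_sum_clog_eq_inv_le hT i
  have h2 := sum_residueDensity_le (R := R) (n₀ := n₀) hP
    (S := (Icc 1 N).filter (Nat.clog 2 · = i)) (T := T.filter (Nat.clog 2 · = i))
    fun p hp hpP => by simp only [T, mem_filter] at hp ⊢; tauto
  calc _ ≤ (i : ℝ) * (#R * ∑ p ∈ T with Nat.clog 2 p = i, (p : ℝ)⁻¹) := by gcongr
    _ = #R * (i * ∑ p ∈ T with Nat.clog 2 p = i, (p : ℝ)⁻¹) := by ring
    _ ≤ #R * 8 := by gcongr
    _ = _ := by ring

lemma sum_card_formResidues_mul_clog_le (hP : ∀ p ∈ P, p.Prime ∧ ¬ p ∣ W) (N i : ℕ) :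
    ∑ p ∈ Icc 1 N with Nat.clog 2 p ≤ i, (#(formResidues P R W n₀ p) : ℝ) * Nat.clog 2 p ≤
      4 * #R * 2 ^ i := by
  classical
  set T := (Icc 1 N).filter (· ∈ P)
  have hT : ∀ p ∈ T, p.Prime := fun p hp => (hP p (mem_filter.1 hp).2).1
  have h1 := sum_clog_le hT i
  have h2 : ∑ p ∈ Icc 1 N with Nat.clog 2 p ≤ i,
      (#(formResidues P R W n₀ p) : ℝ) * Nat.clog 2 p ≤
        ∑ p ∈ T with Nat.clog 2 p ≤ i, (#R : ℝ) * Nat.clog 2 p := by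
    have : ∑ p ∈ Icc 1 N with Nat.clog 2 p ≤ i,
        (#(formResidues P R W n₀ p) : ℝ) * Nat.clog 2 p = ∑ p ∈ T with Nat.clog 2 p ≤ i,
          (#(formResidues P R W n₀ p) : ℝ) * Nat.clog 2 p := by
      refine (sum_subset (fun p hp => ?_) fun p hp hp' => ?_).symm
      · simp only [T, mem_filter] at hp ⊢; tauto
      · have : p ∉ P := fun h => hp' (by simp only [T, mem_filter] at hp ⊢; tauto)
        simp [formResidues_eq_empty this]
    rw [this]
    refine sum_le_sum fun p _ => ?_
    gcongr
    exact card_formResidues_le hP p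
  rw [← mul_sum] at h2
  nlinarith [(Nat.cast_nonneg #R : (0 : ℝ) ≤ _)]

end FormResidues

/-! ### Totient valuations and auxiliary growth estimates -/

lemma padicValNat_totient_le {ℓ N : ℕ} [hℓ : Fact ℓ.Prime] (hN : N ≠ 0) :
    padicValNat ℓ N.totient ≤
      padicValNat ℓ N + ∑ p ∈ N.primeFactors, padicValNat ℓ (p - 1) := by
  have h := Nat.totient_mul_prod_primeFactors N
  have hφ : N.totient ≠ 0 := (Nat.totient_pos.2 (Nat.pos_of_ne_zero hN)).ne'
  have hp1 : ∀ p ∈ N.primeFactors, p - 1 ≠ 0 := fun p hp => by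
    have := (Nat.prime_of_mem_primeFactors hp).two_le; omega
  have h1 : padicValNat ℓ (N.totient * ∏ p ∈ N.primeFactors, p) =
      padicValNat ℓ (N * ∏ p ∈ N.primeFactors, (p - 1)) := by rw [h]
  rw [padicValNat.mul hφ (prod_ne_zero_iff.2 fun p hp => (Nat.prime_of_mem_primeFactors hp).ne_zero),
    padicValNat.mul hN (prod_ne_zero_iff.2 hp1)] at h1
  have h2 : padicValNat ℓ (∏ p ∈ N.primeFactors, (p - 1)) =
      ∑ p ∈ N.primeFactors, padicValNat ℓ (p - 1) := by
    rw [← Nat.factorization_def _ hℓ.out, Nat.factorization_prod hp1, Finsupp.coe_finsetSum,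
      Finset.sum_apply]
    exact sum_congr rfl fun p _ => Nat.factorization_def _ hℓ.out
  omega

lemma one_add_le_one_sub_mul_exp {x : ℝ} (h0 : 0 ≤ x) (h1 : x ≤ 1 / 2) :
    1 + x ≤ (1 - x) * Real.exp (2 * x + 2 * x ^ 2) := by
  have h2 := Real.quadratic_le_exp_of_nonneg (by positivity : 0 ≤ 2 * x + 2 * x ^ 2)
  have h3 := mul_le_mul_of_nonneg_left h2 (by linarith : 0 ≤ 1 - x)
  have h4 : 0 ≤ (1 - x) * (4 * x ^ 3 + 2 * x ^ 4) :=
    mul_nonneg (by linarith) (by positivity)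
  nlinarith [mul_nonneg (sq_nonneg x) (by linarith : 0 ≤ 1 - 2 * x)]

/-- In dimension `κ` the exponential is of order `J ^ (2 * κ)` at `N = 2 ^ J`. This doubling is the
source of the threshold `1 / 2`. -/
lemma dualDensity_le_siftedDensity_mul_exp {h : ℕ → ℝ} (h0 : ∀ m, 0 ≤ h m)
    (h1 : ∀ m, h m ≤ 1 / 2) (N : ℕ) : dualDensity h N ≤
      siftedDensity h N * Real.exp (2 * ∑ m ∈ Icc 1 N, h m + 2 * ∑ m ∈ Icc 1 N, h m ^ 2) := by
  rw [mul_sum, mul_sum, ← sum_add_distrib, Real.exp_sum, dualDensity, siftedDensity,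
    ← prod_mul_distrib]
  exact prod_le_prod (fun m _ => by linarith [h0 m]) fun m _ =>
    one_add_le_one_sub_mul_exp (h0 m) (h1 m)

lemma siftedDensity_pos {h : ℕ → ℝ} (h1 : ∀ m, h m ≤ 1 / 2) (N : ℕ) : 0 < siftedDensity h N :=
  prod_pos fun m _ => by linarith [h1 m]

/-- The values of finitely many linear forms grow at most linearly. -/
lemma exists_abs_linForm_le (R : Finset ℚ) (W n₀ : ℕ) :
    ∃ D : ℕ, 0 < D ∧ ∀ r ∈ R, ∀ t : ℕ,
      |linForm r ((W * t + n₀ : ℕ) : ℤ)| ≤ ((D * (t + 1) : ℕ) : ℤ) := by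
  refine ⟨∑ r ∈ R, (r.den * (W + n₀) + r.num.natAbs) + 1, by omega, fun r hr t => ?_⟩
  have h1 : r.den * (W + n₀) + r.num.natAbs ≤ ∑ r ∈ R, (r.den * (W + n₀) + r.num.natAbs) :=
    single_le_sum (f := fun r : ℚ => r.den * (W + n₀) + r.num.natAbs) (fun _ _ => Nat.zero_le _) hr
  set D := ∑ r ∈ R, (r.den * (W + n₀) + r.num.natAbs)
  have h2 : |linForm r ((W * t + n₀ : ℕ) : ℤ)| ≤
      ((r.den * (W * t + n₀) + r.num.natAbs : ℕ) : ℤ) := by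
    unfold linForm
    refine (abs_sub _ _).trans ?_
    rw [abs_of_nonneg (by positivity)]
    push_cast
    exact le_rfl
  refine h2.trans ?_
  have h3 : r.den * (W * t + n₀) + r.num.natAbs ≤ (r.den * (W + n₀) + r.num.natAbs) * (t + 1) := by
    nlinarith [Nat.zero_le (r.den * W), Nat.zero_le (r.den * n₀ * t),
      Nat.zero_le (r.num.natAbs * t)]
  exact_mod_cast h3.trans (Nat.mul_le_mul_right _ (h1.trans (by omega)))

lemma le_of_dvd_linForm {R : Finset ℚ} {W n₀ D : ℕ} (hD : ∀ r ∈ R, ∀ t : ℕ,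
      |linForm r ((W * t + n₀ : ℕ) : ℤ)| ≤ ((D * (t + 1) : ℕ) : ℤ)) {r : ℚ} (hr : r ∈ R) {t p : ℕ}
    (h0 : linForm r ((W * t + n₀ : ℕ) : ℤ) ≠ 0)
    (hp : (p : ℤ) ∣ linForm r ((W * t + n₀ : ℕ) : ℤ)) : p ≤ D * (t + 1) := by
  have h1 := Int.le_of_dvd (abs_pos.2 h0) ((dvd_abs _ _).2 hp)
  exact_mod_cast h1.trans (hD r hr t)

/-- Exponential growth beats linear growth at the logarithms of the integers. -/
lemma exists_log_lt_exp {δ : ℝ} (hδ : 0 < δ) (C : ℝ) :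
    ∃ J : ℕ, 1 ≤ J ∧ C * (1 + Real.log J) < Real.exp (δ * Real.log J) := by
  obtain ⟨J, hJ⟩ := exists_nat_gt (Real.exp (4 * |C| / δ ^ 2 + 1))
  have hpos : (0 : ℝ) < J := (Real.exp_pos _).trans hJ
  refine ⟨J, by exact_mod_cast hpos, ?_⟩
  have hu : 4 * |C| / δ ^ 2 + 1 < Real.log J := (Real.lt_log_iff_exp_lt hpos).2 hJ
  set u := Real.log J
  have h0 : 0 ≤ 4 * |C| / δ ^ 2 := by positivity
  have h1 : 4 * |C| < δ ^ 2 * u := by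
    have : 4 * |C| / δ ^ 2 < u := by linarith
    rw [div_lt_iff₀ (by positivity)] at this
    linarith
  have h2 := Real.quadratic_le_exp_of_nonneg (by nlinarith : 0 ≤ δ * u)
  nlinarith [le_abs_self C, abs_nonneg C]

lemma sum_residueDensity_sq_le {P : Set ℕ} {R : Finset ℚ} {W n₀ : ℕ}
    (hP : ∀ p ∈ P, p.Prime ∧ ¬ p ∣ W) (N : ℕ) :
    ∑ m ∈ Icc 1 N, residueDensity (formResidues P R W n₀) m ^ 2 ≤ (#R : ℝ) ^ 2 * 2 := by
  have h1 : ∑ m ∈ Icc 1 N, residueDensity (formResidues P R W n₀) m ^ 2 ≤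
      ∑ m ∈ Icc 1 N, (#R : ℝ) ^ 2 * ((m : ℝ) ^ 2)⁻¹ := by
    refine sum_le_sum fun m _ => ?_
    rw [← inv_pow, ← mul_pow]
    exact pow_le_pow_left₀ (residueDensity_nonneg _ m) (residueDensity_formResidues_le hP m) 2
  rw [← mul_sum] at h1
  exact h1.trans (mul_le_mul_of_nonneg_left
    (sum_inv_sq_le_two fun p hp => (mem_Icc.1 hp).1) (by positivity))

/-! ### Dimension below one half: avoiding all primes congruent to `1` modulo `ℓ` -/

section SmallDimension

variable {k ℓ n₀ : ℕ} {R : Finset ℚ}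

/-- If every integer is hit, then the main term of the lower sieve is at most as large as its
remainder term. -/
lemma lowerSieve_div_dualDensity_le {P : Set ℕ} {W : ℕ} (hP : ∀ p ∈ P, p.Prime ∧ ¬ p ∣ W)
    (hP2 : ∀ p ∈ P, 2 * #R ≤ p) {D : ℕ} (hD0 : 0 < D)
    (hhit : ∀ t : ℕ, ∃ p ∈ P, p ≤ D * (t + 1) ∧
      ∃ r ∈ R, (p : ℤ) ∣ linForm r ((W * t + n₀ : ℕ) : ℤ)) (j : ℕ) :
    max (lowerSieve 1 (residueDensity (formResidues P R W n₀)) (2 ^ j) j) 0 /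
      dualDensity (residueDensity (formResidues P R W n₀)) (2 ^ j) ≤
        (4 * D * (4 * #R + 1)) / (j + 1) := by
  set Ω := formResidues P R W n₀ with hΩ
  set g := residueDensity Ω with hg
  have g0 : ∀ m, 0 ≤ g m := residueDensity_nonneg Ω
  have g1 : ∀ m, g m ≤ 1 := fun m =>
    (residueDensity_formResidues_le_half hP hP2 m).trans (by norm_num)
  have hΓ := one_le_dualDensity g0 (2 ^ j)
  have hD1 : (1 : ℝ) ≤ D := by exact_mod_cast hD0
  have hR0 : (0 : ℝ) ≤ #R := Nat.cast_nonneg _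
  have hL1 : lowerSieve 1 g (2 ^ j) j ≤ 1 :=
    (lowerSieve_le_siftedDensity_le_upperSieve 1 g0 g1 _ j).1.trans (siftedDensity_le_one g0 g1 _)
  rw [div_le_div_iff₀ (by linarith) (by positivity)]
  -- At these levels the trivial bounds `L ≤ 1`, `1 ≤ Γ` and `j + 1 ≤ D` suffice.
  by_cases hj : 2 ^ j < D ∨ j = 0
  · have h1 : ((j : ℝ) + 1) ≤ D := by
      have : j < 2 ^ j := Nat.lt_two_pow_self
      exact_mod_cast (by omega : j + 1 ≤ D)
    have h2 : max (lowerSieve 1 g (2 ^ j) j) 0 ≤ 1 := max_le hL1 zero_le_one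
    have h3 : max (lowerSieve 1 g (2 ^ j) j) 0 * ((j : ℝ) + 1) ≤ 1 * D :=
      mul_le_mul h2 h1 (by positivity) zero_le_one
    have h4 : (D : ℝ) ≤ 4 * D * (4 * #R + 1) := by nlinarith
    nlinarith [mul_le_mul h4 hΓ zero_le_one (by positivity)]
  push Not at hj
  obtain ⟨hj1, hj0⟩ := hj
  -- For `t < x` the hitting primes are at most `D * x ≤ 2 ^ j`, so the sieve up to `2 ^ j` sees a
  -- hit at every `t`.
  set x := 2 ^ j / D with hx
  have hx1 : 1 ≤ x := Nat.div_pos hj1 hD0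
  have hxD : D * x ≤ 2 ^ j := Nat.mul_div_le _ _
  have hx2 : 2 ^ j ≤ 2 * D * x := by
    have := Nat.lt_mul_div_succ (2 ^ j) hD0
    rw [← hx] at this
    nlinarith
  have hdist := (abs_sum_sieve_sub_le (Ω := Ω) lt_of_mem_formResidues
    (coprime_of_formResidues_nonempty hP) le_rfl x (2 ^ j) j 1 0 one_pos
    fun p _ _ => Nat.coprime_one_left p).2
  have hneg : ∑ t ∈ range x with t ≡ 0 [MOD 1], lowerSieve 1 (residueHit Ω t) (2 ^ j) j ≤ 0 := by
    refine sum_nonpos fun t ht => ?_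
    have ht := mem_range.1 (mem_filter.1 ht).1
    obtain ⟨p, hpP, hpD, hr⟩ := hhit t
    have hp0 := (hP p hpP).1.pos
    refine lowerSieve_residueHit_nonpos 1 (p := p) (mem_Icc.2 ⟨hp0, hpD.trans ?_⟩)
      ((mod_mem_formResidues_iff hpP hp0).2 hr) j
    exact (Nat.mul_le_mul_left D ht).trans hxD
  have hmain : x * lowerSieve 1 g (2 ^ j) j ≤ sieveRemainder Ω (2 ^ j) j := by
    have := (abs_le.1 hdist).1
    rw [Nat.cast_one, div_one] at this
    linarith
  have hrem := mul_sieveRemainder_le (2 ^ j) j (K := 4 * #R)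
    (sum_card_formResidues_mul_clog_le (R := R) (n₀ := n₀) hP (2 ^ j))
  have hx2' : (2 : ℝ) ^ j ≤ 2 * D * x := by exact_mod_cast hx2
  have hx0 : (0 : ℝ) < x := by exact_mod_cast hx1
  have hmain' : x * max (lowerSieve 1 g (2 ^ j) j) 0 ≤ sieveRemainder Ω (2 ^ j) j := by
    rcases max_cases (lowerSieve 1 g (2 ^ j) j) 0 with h | h <;> rw [h.1]
    · exact hmain
    · rw [mul_zero]; exact sieveRemainder_nonneg Ω _ _
  have hj1' : (1 : ℝ) ≤ j := by exact_mod_cast Nat.pos_of_ne_zero hj0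
  set L := max (lowerSieve 1 g (2 ^ j) j) 0
  have hL0 : 0 ≤ L := le_max_right _ _
  refine le_of_mul_le_mul_left ?_ hx0
  -- The factor `4` in the bound comes from `j + 1 ≤ 2 * j` here and from `2 ^ j ≤ 2 * D * x`.
  have s1 : x * (L * (j + 1)) ≤ 2 * (j * (x * L)) := by
    nlinarith [mul_nonneg hx0.le hL0]
  have s2 : j * (x * L) ≤ (4 * #R + 1) * 2 ^ j * dualDensity g (2 ^ j) :=
    (mul_le_mul_of_nonneg_left hmain' (by linarith)).trans hrem
  have s3 : (4 * (#R : ℝ) + 1) * 2 ^ j * dualDensity g (2 ^ j) ≤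
      (4 * #R + 1) * (2 * D * x) * dualDensity g (2 ^ j) := by gcongr
  linarith

/-- In dimension below `1 / 2`, the values of linear forms avoid the primes congruent to `1`
modulo `ℓ` simultaneously. -/
theorem exists_linForm_avoid_primes (hℓ : ℓ.Prime) (hR : 2 * #R + 1 < ℓ)
    (hn₀ : ∀ r ∈ R, ¬ (ℓ : ℤ) ∣ linForm r n₀) :
    ∃ t : ℕ, ∀ r ∈ R, ∀ p : ℕ, p.Prime → (p : ZMod ℓ) = 1 →
      ¬ (p : ℤ) ∣ linForm r ((ℓ * t + n₀ : ℕ) : ℤ) := by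
  by_contra! hcon
  have : NeZero ℓ := ⟨hℓ.ne_zero⟩
  have : Fact (1 < ℓ) := ⟨hℓ.one_lt⟩
  set P : Set ℕ := {p | p.Prime ∧ (p : ZMod ℓ) = 1} with hPdef
  have hP : ∀ p ∈ P, p.Prime ∧ ¬ p ∣ ℓ := fun p hp => ⟨hp.1, fun hd => by
    have h2 := hp.2
    rw [(Nat.prime_dvd_prime_iff_eq hp.1 hℓ).1 hd, ZMod.natCast_self] at h2
    exact zero_ne_one h2⟩
  have hP2 : ∀ p ∈ P, 2 * #R ≤ p := fun p hp => by
    have h1 : p ≡ 1 [MOD ℓ] := (ZMod.natCast_eq_natCast_iff p 1 ℓ).1 (by simpa using hp.2)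
    have h2 : ℓ ∣ p - 1 := (Nat.modEq_iff_dvd' hp.1.one_le).1 h1.symm
    have := Nat.le_of_dvd (by have := hp.1.two_le; omega) h2
    omega
  obtain ⟨D, hD0, hD⟩ := exists_abs_linForm_le R ℓ n₀
  have hne : ∀ r ∈ R, ∀ t : ℕ, linForm r ((ℓ * t + n₀ : ℕ) : ℤ) ≠ 0 := fun r hr t h0 => by
    refine hn₀ r hr ?_
    have h1 := linForm_sub r ((ℓ * t + n₀ : ℕ) : ℤ) n₀
    rw [h0] at h1
    refine ⟨-(r.den * t), ?_⟩
    push_cast at h1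
    linarith
  have hhit : ∀ t : ℕ, ∃ p ∈ P, p ≤ D * (t + 1) ∧
      ∃ r ∈ R, (p : ℤ) ∣ linForm r ((ℓ * t + n₀ : ℕ) : ℤ) := fun t => by
    obtain ⟨r, hr, p, hp, hp1, hd⟩ := hcon t
    exact ⟨p, ⟨hp, hp1⟩, le_of_dvd_linForm hD hr (hne r hr t) hd, r, hr, hd⟩
  have hj := lowerSieve_div_dualDensity_le hP hP2 hD0 hhit
  set Ω := formResidues P R ℓ n₀ with hΩ
  set g := residueDensity Ω with hg
  have g0 : ∀ m, 0 ≤ g m := residueDensity_nonneg Ω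
  have g1 : ∀ m, g m ≤ 1 / 2 := residueDensity_formResidues_le_half hP hP2
  obtain ⟨C, hC⟩ := exists_sum_inv_prime_le (q := ℓ) (a := 1) isUnit_one
  -- Twice the sieve dimension `#R / φ(ℓ)`; the hypothesis `2 * #R + 1 < ℓ` is exactly `κ < 1`.
  set κ : ℝ := 2 * #R / (ℓ - 1 : ℕ) with hκ
  have hφ : ℓ.totient = ℓ - 1 := Nat.totient_prime hℓ
  have hκ1 : κ < 1 := by
    have h1 : 2 * #R < ℓ - 1 := by omega
    have h2 : (0 : ℝ) < (ℓ - 1 : ℕ) := by exact_mod_cast (by omega : 0 < ℓ - 1)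
    rw [hκ, div_lt_one h2]
    exact_mod_cast h1
  set C₁ : ℝ := 4 * D * (4 * #R + 1) with hC₁
  have hC₁0 : 0 ≤ C₁ := by positivity
  obtain ⟨J, hJ1, hJ⟩ := exists_log_lt_exp (sub_pos.2 hκ1)
    (Real.exp (2 * #R * C + 4 * #R ^ 2) * C₁)
  have hJ0 : (0 : ℝ) < J := by exact_mod_cast hJ1
  have hsieve := mul_siftedDensity_le_sum_lowerSieve g0
    (fun m => (g1 m).trans (by norm_num)) J
  have hsum : ∑ j ∈ range J, max (lowerSieve 1 g (2 ^ j) j) 0 / dualDensity g (2 ^ j) ≤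
      C₁ * (1 + Real.log J) := by
    refine (sum_le_sum fun j _ => hj j).trans ?_
    have h1 := harmonic_le_one_add_log J
    have h2 : ∑ j ∈ range J, C₁ / ((j : ℝ) + 1) = C₁ * (harmonic J : ℝ) := by
      rw [harmonic, Rat.cast_sum, mul_sum]
      exact sum_congr rfl fun j _ => by push_cast; rw [div_eq_mul_inv]
    rw [h2]
    exact mul_le_mul_of_nonneg_left h1 hC₁0
  classical
  set T := (Icc 1 (2 ^ J)).filter (· ∈ P)
  have hT : ∀ p ∈ T, p.Prime ∧ (p : ZMod ℓ) = 1 ∧ p ≤ 2 ^ J := fun p hp => by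
    have := mem_filter.1 hp
    exact ⟨this.2.1, this.2.2, (mem_Icc.1 this.1).2⟩
  have hs1 : ∑ m ∈ Icc 1 (2 ^ J), g m ≤ #R * (Real.log J / (ℓ - 1 : ℕ) + C) := by
    refine (sum_residueDensity_le (T := T) hP fun p hp hpP => mem_filter.2 ⟨hp, hpP⟩).trans ?_
    have := hC J T hJ1 hT
    rw [hφ] at this
    gcongr
  have hs2 : ∑ m ∈ Icc 1 (2 ^ J), g m ^ 2 ≤ #R ^ 2 * 2 := sum_residueDensity_sq_le hP _
  have hΓ := dualDensity_le_siftedDensity_mul_exp g0 g1 (2 ^ J)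
  have hV := siftedDensity_pos g1 (2 ^ J)
  set V := siftedDensity g (2 ^ J)
  have hexp : Real.exp (2 * ∑ m ∈ Icc 1 (2 ^ J), g m + 2 * ∑ m ∈ Icc 1 (2 ^ J), g m ^ 2) ≤
      Real.exp (2 * #R * C + 4 * #R ^ 2) * Real.exp (κ * Real.log J) := by
    rw [← Real.exp_add, Real.exp_le_exp]
    have : κ * Real.log J = 2 * (#R * (Real.log J / (ℓ - 1 : ℕ))) := by rw [hκ]; ring
    rw [this]
    linarith
  have hlog : 0 ≤ Real.log J := Real.log_natCast_nonneg J
  have hfin : J * V ≤ V * (Real.exp (2 * #R * C + 4 * #R ^ 2) * Real.exp (κ * Real.log J)) *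
      (C₁ * (1 + Real.log J)) := by
    refine hsieve.trans (mul_le_mul (hΓ.trans (mul_le_mul_of_nonneg_left hexp hV.le)) hsum
      (sum_nonneg fun j _ => div_nonneg (le_max_right _ _)
        (zero_le_one.trans (one_le_dualDensity g0 _))) (by positivity))
  have hJe : (J : ℝ) = Real.exp ((1 - κ) * Real.log J) * Real.exp (κ * Real.log J) := by
    rw [← Real.exp_add, ← add_mul, sub_add_cancel, one_mul, Real.exp_log hJ0]
  have hE := Real.exp_pos (κ * Real.log J)
  have h1 : J * V = V * Real.exp (κ * Real.log J) * Real.exp ((1 - κ) * Real.log J) := by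
    calc J * V = Real.exp ((1 - κ) * Real.log J) * Real.exp (κ * Real.log J) * V := by rw [← hJe]
      _ = _ := by ring
  rw [h1] at hfin
  have h2 : V * (Real.exp (2 * #R * C + 4 * #R ^ 2) * Real.exp (κ * Real.log J)) *
      (C₁ * (1 + Real.log J)) = V * Real.exp (κ * Real.log J) *
        (Real.exp (2 * #R * C + 4 * #R ^ 2) * C₁ * (1 + Real.log J)) := by ring
  rw [h2] at hfin
  exact absurd (le_of_mul_le_mul_left hfin (mul_pos hV hE)) (not_le.2 hJ)

end SmallDimension

/-! ### A base point with controlled smooth and rough parts -/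

/-- The part of a positive integer that is composed of the primes in `Q`, and the remaining
cofactor. -/
lemma exists_eq_smooth_mul_rough {Q : Finset ℕ} (hQ : ∀ p ∈ Q, p.Prime) (m : ℕ) (hm : 0 < m) :
    ∃ b c : ℕ, m = b * c ∧ (∀ p : ℕ, p.Prime → p ∣ b → p ∈ Q) ∧ ∀ p ∈ Q, ¬ p ∣ c := by
  induction m using Nat.strong_induction_on with
  | _ m ih =>
    by_cases h : ∃ p ∈ Q, p ∣ m
    · obtain ⟨p, hp, d, rfl⟩ := h
      have hd : 0 < d := Nat.pos_of_mul_pos_left hm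
      obtain ⟨b, c, rfl, h1, h2⟩ := ih d (by nlinarith [(hQ p hp).two_le]) hd
      refine ⟨p * b, c, by ring, fun q hq hqd => ?_, h2⟩
      rcases (Nat.Prime.dvd_mul hq).1 hqd with h | h
      · rwa [(Nat.prime_dvd_prime_iff_eq hq (hQ p hp)).1 h]
      · exact h1 q hq h
    · push Not at h
      exact ⟨1, m, by ring, fun p hp hd => absurd (Nat.dvd_one.1 hd) hp.ne_one, h⟩

/-- At `n₀` the linear forms in `R` have positive values `b r * c r`, where `b r` is composed of
the primes in `Q` and bounded at `ℓ`, while `c r` is free of these primes. -/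
structure SmoothRoughValues (k ℓ : ℕ) (R : Finset ℚ) (Q : Finset ℕ) (n₀ : ℕ) (b c : ℚ → ℕ) :
    Prop where
  prime : ∀ p ∈ Q, p.Prime
  mem : ℓ ∈ Q
  value : ∀ r ∈ R, linForm r n₀ = b r * c r
  pos : ∀ r ∈ R, 0 < b r
  pos' : ∀ r ∈ R, 0 < c r
  smooth : ∀ r ∈ R, ∀ p : ℕ, p.Prime → p ∣ b r → p ∈ Q
  rough : ∀ r ∈ R, ∀ p ∈ Q, ¬ p ∣ c r
  bounded : ∀ r ∈ R, ¬ ℓ ^ k ∣ b r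

/-- A modulus that preserves the decomposition of the values into smooth and rough parts. -/
def stableModulus (ℓ : ℕ) (R : Finset ℚ) (Q : Finset ℕ) (b : ℚ → ℕ) : ℕ :=
  (∏ r ∈ R, b r) * ((∏ p ∈ Q, p) * ℓ ^ 3)

namespace SmoothRoughValues

variable {k ℓ n₀ : ℕ} {R : Finset ℚ} {Q : Finset ℕ} {b c : ℚ → ℕ}

lemma stableModulus_pos (H : SmoothRoughValues k ℓ R Q n₀ b c) :
    0 < stableModulus ℓ R Q b :=
  Nat.mul_pos (prod_pos H.pos) (Nat.mul_pos (prod_pos fun p hp => (H.prime p hp).pos)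
    (pow_pos (H.prime ℓ H.mem).pos 3))

lemma prime_dvd_stableModulus_iff (H : SmoothRoughValues k ℓ R Q n₀ b c) {p : ℕ}
    (hp : p.Prime) : p ∣ stableModulus ℓ R Q b ↔ p ∈ Q := by
  constructor
  · intro h
    rcases (Nat.Prime.dvd_mul hp).1 h with h | h
    · obtain ⟨r, hr, hd⟩ := (Prime.dvd_finsetProd_iff hp.prime _).1 h
      exact H.smooth r hr p hp hd
    rcases (Nat.Prime.dvd_mul hp).1 h with h | h
    · obtain ⟨q, hq, hd⟩ := (Prime.dvd_finsetProd_iff hp.prime _).1 h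
      rwa [(Nat.prime_dvd_prime_iff_eq hp (H.prime q hq)).1 hd]
    · rw [(Nat.prime_dvd_prime_iff_eq hp (H.prime ℓ H.mem)).1 (hp.dvd_of_dvd_pow h)]
      exact H.mem
  · intro h
    exact Dvd.dvd.mul_left (Dvd.dvd.mul_right (dvd_prod_of_mem _ h) _) _

/-- The values in the progression modulo the stable modulus. -/
lemma exists_value_eq (H : SmoothRoughValues k ℓ R Q n₀ b c) {r : ℚ} (hr : r ∈ R) :
    ∃ d : ℕ, 0 < d ∧ stableModulus ℓ R Q b = b r * d ∧ (∀ p ∈ Q, p ∣ d) ∧ ℓ ^ 3 ∣ d ∧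
      ∀ s : ℕ, linForm r ((stableModulus ℓ R Q b * s + n₀ : ℕ) : ℤ) =
        b r * ((c r + r.den * d * s : ℕ) : ℤ) := by
  obtain ⟨e, he⟩ := dvd_prod_of_mem b hr
  have hM : stableModulus ℓ R Q b = b r * (e * ((∏ p ∈ Q, p) * ℓ ^ 3)) := by
    rw [stableModulus, he]; ring
  refine ⟨e * ((∏ p ∈ Q, p) * ℓ ^ 3), ?_, hM, fun p hp => ?_, ?_, fun s => ?_⟩
  · have := H.stableModulus_pos
    rw [hM] at this
    exact Nat.pos_of_mul_pos_left this
  · exact Dvd.dvd.mul_left (Dvd.dvd.mul_right (dvd_prod_of_mem _ hp) _) _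
  · exact Dvd.dvd.mul_left (Dvd.intro_left _ rfl) _
  · have h1 := linForm_sub r ((stableModulus ℓ R Q b * s + n₀ : ℕ) : ℤ) n₀
    have h2 := H.value r hr
    rw [h2] at h1
    have hM' : (stableModulus ℓ R Q b : ℤ) = b r * (e * ((∏ p ∈ Q, p) * ℓ ^ 3) : ℕ) := by
      rw [hM]; push_cast; ring
    push_cast at h1 hM' ⊢
    rw [hM'] at h1 ⊢
    linear_combination h1

/-- Along the progression the rough part changes by a multiple of every prime in `Q` and of `ℓ ^ 3`.
-/
lemma exists_value_eq_rough (H : SmoothRoughValues k ℓ R Q n₀ b c) {r : ℚ} (hr : r ∈ R) (s : ℕ) :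
    ∃ c' : ℕ, linForm r ((stableModulus ℓ R Q b * s + n₀ : ℕ) : ℤ) = b r * c' ∧ 0 < c' ∧
      (∀ p ∈ Q, ¬ p ∣ c') ∧ c' ≡ c r [MOD ℓ ^ 3] := by
  obtain ⟨d, hd0, -, hdQ, hdℓ, hv⟩ := H.exists_value_eq hr
  refine ⟨_, hv s, by have := H.pos' r hr; omega, fun p hp h => ?_, ?_⟩
  · refine H.rough r hr p hp ((Nat.dvd_add_left ?_).1 h)
    exact Dvd.dvd.mul_right (Dvd.dvd.mul_left (hdQ p hp) _) _
  · refine (Nat.modEq_iff_dvd' (by omega)).2 ?_ |>.symm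
    rw [Nat.add_sub_cancel_left]
    exact Dvd.dvd.mul_right (Dvd.dvd.mul_left hdℓ _) _

end SmoothRoughValues

/-- The base point in the absence of a condition on the rough parts. -/
lemma exists_smoothRoughValues {k ℓ : ℕ} {R : Finset ℚ} (hR : #R ≤ k) (hℓ : ℓ.Prime)
    {Q : Finset ℕ} (hQ : ∀ p ∈ Q, p.Prime) (hℓQ : ℓ ∈ Q) :
    ∃ n₀ b c, SmoothRoughValues k ℓ R Q n₀ b c := by
  obtain ⟨n₁, -, hn₁⟩ := exists_not_pow_dvd_linForm hR hℓ
    (Nat.lt_pow_self hℓ.one_lt : k < ℓ ^ k)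
  set N := ∑ r ∈ R, r.num.natAbs + 1 with hN
  -- A shift by a multiple of `ℓ ^ k` keeps the non-divisibility and makes all values positive.
  set n₀ := n₁ + ℓ ^ k * N with hn₀
  have hpos : ∀ r ∈ R, 0 < linForm r n₀ := fun r hr => by
    have h1 : r.num.natAbs ≤ ∑ r ∈ R, r.num.natAbs :=
      single_le_sum (f := fun r : ℚ => r.num.natAbs) (fun _ _ => Nat.zero_le _) hr
    have h2 : N ≤ n₀ := by
      have := Nat.le_mul_of_pos_left N (pow_pos hℓ.pos k)
      omega
    have h3 : n₀ ≤ r.den * n₀ := Nat.le_mul_of_pos_left _ r.den_pos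
    have h4 : (n₀ : ℤ) ≤ r.den * n₀ := by exact_mod_cast h3
    unfold linForm
    omega
  have hdvd : ∀ r ∈ R, ¬ ((ℓ ^ k : ℕ) : ℤ) ∣ linForm r n₀ := fun r hr h => by
    refine hn₁ r hr ((dvd_iff_dvd_of_dvd_sub ?_).1 h)
    have h2 : ((ℓ ^ k : ℕ) : ℤ) ∣ (n₀ : ℤ) - n₁ := ⟨N, by rw [hn₀]; push_cast; ring⟩
    rw [linForm_sub]
    exact h2.mul_left _
  have hex : ∀ r ∈ R, ∃ bc : ℕ × ℕ, (linForm r n₀).natAbs = bc.1 * bc.2 ∧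
      (∀ p : ℕ, p.Prime → p ∣ bc.1 → p ∈ Q) ∧ ∀ p ∈ Q, ¬ p ∣ bc.2 := fun r hr => by
    obtain ⟨b, c, h1, h2, h3⟩ := exists_eq_smooth_mul_rough hQ (linForm r n₀).natAbs
      (Int.natAbs_pos.2 (hpos r hr).ne')
    exact ⟨(b, c), h1, h2, h3⟩
  choose! bc h1 h2 h3 using hex
  have hval : ∀ r ∈ R, linForm r n₀ = (bc r).1 * (bc r).2 := fun r hr => by
    have := h1 r hr
    rw [← Int.natAbs_of_nonneg (hpos r hr).le, this]
    push_cast; rfl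
  have hmul : ∀ r ∈ R, 0 < (bc r).1 * (bc r).2 := fun r hr => by
    rw [← h1 r hr]; exact Int.natAbs_pos.2 (hpos r hr).ne'
  refine ⟨n₀, fun r => (bc r).1, fun r => (bc r).2, hQ, hℓQ, hval,
    fun r hr => Nat.pos_of_mul_pos_right (hmul r hr),
    fun r hr => Nat.pos_of_mul_pos_left (hmul r hr), h2, h3, fun r hr h => hdvd r hr ?_⟩
  rw [hval r hr]
  exact Dvd.dvd.mul_right (by exact_mod_cast h) _

/-- Adjoining one auxiliary prime changes the rough part of one form modulo `ℓ ^ 3`, but not that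
of the other forms. -/
lemma SmoothRoughValues.exists_insert {k ℓ n₀ : ℕ} {R : Finset ℚ} {Q : Finset ℕ} {b c : ℚ → ℕ}
    (H : SmoothRoughValues k ℓ R Q n₀ b c) {r₀ : ℚ} (hr₀ : r₀ ∈ R)
    (h1 : c r₀ ≡ 1 [MOD ℓ ^ 3]) :
    ∃ q n₀' b' c', q ∉ Q ∧ padicValNat ℓ (q - 1) ≤ 1 ∧
      SmoothRoughValues k ℓ R (insert q Q) n₀' b' c' ∧ ¬ c' r₀ ≡ 1 [MOD ℓ ^ 3] ∧
        ∀ r ∈ R, r ≠ r₀ → c' r ≡ c r [MOD ℓ ^ 3] := by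
  have hℓ := H.prime ℓ H.mem
  have hℓ2 := hℓ.two_le
  set M := stableModulus ℓ R Q b with hM
  have hM0 : 0 < M := H.stableModulus_pos
  -- A prime `q ≡ 1 + ℓ` is not `1` modulo `ℓ ^ 3`, yet `q - 1` has small valuation. Being larger
  -- than the resultants of `r₀` with the other forms, `q` cannot divide a second form together with
  -- that of `r₀`.
  obtain ⟨q, hqgt, hq, hq1⟩ := Nat.forall_exists_prime_gt_and_modEq
    (M + ∑ r ∈ R, (r.den + (r.den * r₀.num - r₀.den * r.num).natAbs))
    (q := ℓ ^ 3) (a := 1 + ℓ) (pow_ne_zero 3 hℓ.ne_zero)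
    (Nat.Coprime.pow_right 3 (by simp))
  have hqM : ¬ q ∣ M := fun h => by have := Nat.le_of_dvd hM0 h; omega
  have hqQ : q ∉ Q := fun h => hqM ((H.prime_dvd_stableModulus_iff hq).2 h)
  have hsum : ∀ r ∈ R, r.den + (r.den * r₀.num - r₀.den * r.num).natAbs < q := fun r hr => by
    have := single_le_sum
      (f := fun r : ℚ => r.den + (r.den * r₀.num - r₀.den * r.num).natAbs)
      (fun _ _ => Nat.zero_le _) hr
    omega
  have hqℓ3 : ¬ q ≡ 1 [MOD ℓ ^ 3] := fun h => by
    have h2 : 1 + ℓ ≡ 1 [MOD ℓ ^ 3] := hq1.symm.trans h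
    have h3 := (Nat.modEq_iff_dvd' (by omega)).1 h2.symm
    rw [Nat.add_sub_cancel_left] at h3
    have := Nat.le_of_dvd hℓ.pos h3
    nlinarith [pow_succ ℓ 2, pow_two ℓ]
  have hval : padicValNat ℓ (q - 1) ≤ 1 := by
    have := Fact.mk hℓ
    by_contra hcon
    have hdvd : ℓ ^ 2 ∣ q - 1 := (pow_dvd_pow ℓ (by omega)).trans pow_padicValNat_dvd
    have h2 : q ≡ 1 + ℓ [MOD ℓ ^ 2] := hq1.of_dvd (pow_dvd_pow ℓ (by norm_num))
    have h3 : q ≡ 1 [MOD ℓ ^ 2] := ((Nat.modEq_iff_dvd' hq.one_le).2 hdvd).symm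
    have h4 := (Nat.modEq_iff_dvd' (by omega : 1 ≤ 1 + ℓ)).1 (h3.symm.trans h2)
    rw [Nat.add_sub_cancel_left] at h4
    have := Nat.le_of_dvd hℓ.pos h4
    nlinarith [pow_two ℓ]
  obtain ⟨d, hd0, hMd, hdQ, hdℓ, hv⟩ := H.exists_value_eq hr₀
  have hqden : ¬ q ∣ r₀.den := fun h => by
    have := Nat.le_of_dvd r₀.den_pos h
    have := hsum r₀ hr₀
    omega
  have hqd : ¬ q ∣ d := fun h => hqM (by rw [hM, hMd]; exact h.mul_left _)
  -- The target `q` modulo `q ^ 2` makes `q` divide the rough part exactly once.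
  obtain ⟨s, hs⟩ : ∃ s, c r₀ + r₀.den * d * s ≡ q [MOD q ^ 2] := by
    have hcop : IsCoprime ((r₀.den * d : ℕ) : ℤ) ((q ^ 2 : ℕ) : ℤ) := by
      refine Nat.isCoprime_iff_coprime.2 (Nat.Coprime.pow_right 2 (Nat.Coprime.symm ?_))
      exact (Nat.Prime.coprime_iff_not_dvd hq).2 fun h =>
        ((Nat.Prime.dvd_mul hq).1 h).elim hqden hqd
    obtain ⟨u, v, huv⟩ := hcop
    have hq2 : (0 : ℤ) < ((q ^ 2 : ℕ) : ℤ) := by exact_mod_cast pow_pos hq.pos 2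
    set z := (u * ((q : ℤ) - c r₀)) % ((q ^ 2 : ℕ) : ℤ) with hz
    have hz0 : 0 ≤ z := Int.emod_nonneg _ hq2.ne'
    refine ⟨z.toNat, ?_⟩
    rw [← Int.natCast_modEq_iff]
    push_cast [Int.toNat_of_nonneg hz0]
    have hzmod : z ≡ u * ((q : ℤ) - c r₀) [ZMOD (q : ℤ) ^ 2] := by
      rw [hz]; push_cast; exact Int.mod_modEq _ _
    have e1 := (hzmod.mul_left (r₀.den * d : ℤ)).add_left (c r₀ : ℤ)
    refine e1.trans ?_
    refine (Int.modEq_iff_dvd.2 ⟨v * ((q : ℤ) - c r₀), ?_⟩)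
    push_cast at huv
    linear_combination (-(q : ℤ) + c r₀) * huv
  set n₀' := M * s + n₀ with hn₀'
  obtain ⟨u, hu⟩ : q ∣ c r₀ + r₀.den * d * s :=
    (hs.dvd_iff (dvd_pow_self q two_ne_zero)).2 dvd_rfl
  have hqu : ¬ q ∣ u := fun ⟨w, hw⟩ => by
    have h2 : q ^ 2 ∣ c r₀ + r₀.den * d * s := ⟨w, by rw [hu, hw]; ring⟩
    have h3 : q ^ 2 ∣ q := (hs.dvd_iff dvd_rfl).1 h2
    have := Nat.le_of_dvd hq.pos h3
    nlinarith [hq.two_le]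
  have hex : ∀ r ∈ R, ∃ c' : ℕ, linForm r (n₀' : ℤ) = b r * c' ∧ 0 < c' ∧
      (∀ p ∈ Q, ¬ p ∣ c') ∧ c' ≡ c r [MOD ℓ ^ 3] := fun r hr => H.exists_value_eq_rough hr s
  choose! e he1 he2 he3 he4 using hex
  have hbr : (b r₀ : ℤ) ≠ 0 := by exact_mod_cast (H.pos r₀ hr₀).ne'
  have her₀ : e r₀ = q * u := by
    have h2 := he1 r₀ hr₀
    have h3 := hv s
    rw [hn₀', h3] at h2
    have := mul_left_cancel₀ hbr h2
    rw [← hu]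
    exact_mod_cast this.symm
  have hqe : ∀ r ∈ R, r ≠ r₀ → ¬ q ∣ e r := fun r hr hne hd => by
    have h2 : (q : ℤ) ∣ linForm r (n₀' : ℤ) := by
      rw [he1 r hr]; exact Dvd.dvd.mul_left (by exact_mod_cast hd) _
    have h3 : (q : ℤ) ∣ linForm r₀ (n₀' : ℤ) := by
      rw [he1 r₀ hr₀, her₀]; exact Dvd.dvd.mul_left (by exact_mod_cast Dvd.intro u rfl) _
    have h4 : (q : ℤ) ∣ r.den * r₀.num - r₀.den * r.num := by
      have : (r.den : ℤ) * r₀.num - r₀.den * r.num =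
          r₀.den * linForm r (n₀' : ℤ) - r.den * linForm r₀ (n₀' : ℤ) := by
        unfold linForm; ring
      rw [this]
      exact dvd_sub (h2.mul_left _) (h3.mul_left _)
    have h5 := Int.natAbs_eq_zero.1 (Nat.eq_zero_of_dvd_of_lt (Int.natCast_dvd.1 h4)
      (by have := hsum r hr; omega))
    apply hne
    have h6 : (r.den : ℚ) * r₀.num = r₀.den * r.num := by exact_mod_cast sub_eq_zero.1 h5
    have hd1 : (r.den : ℚ) ≠ 0 := by exact_mod_cast r.den_nz
    have hd2 : (r₀.den : ℚ) ≠ 0 := by exact_mod_cast r₀.den_nz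
    rw [← Rat.num_div_den r, ← Rat.num_div_den r₀]
    rw [div_eq_div_iff hd1 hd2]
    linarith
  have hu0 : 0 < u := by
    have := he2 r₀ hr₀
    rw [her₀] at this
    exact Nat.pos_of_mul_pos_left this
  refine ⟨q, n₀', fun r => if r = r₀ then b r * q else b r,
    fun r => if r = r₀ then u else e r, hqQ, hval, ⟨?_, ?_, ?_, ?_, ?_, ?_, ?_, ?_⟩, ?_, ?_⟩
  · intro p hp
    rcases mem_insert.1 hp with rfl | hp
    · exact hq
    · exact H.prime p hp
  · exact mem_insert_of_mem H.mem
  · intro r hr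
    rw [he1 r hr]
    by_cases h : r = r₀
    · subst h
      simp only [if_true, her₀]
      push_cast; ring
    · simp only [h, if_false]
  · intro r hr
    by_cases h : r = r₀
    · simp only [h, if_true]; exact Nat.mul_pos (H.pos r₀ hr₀) hq.pos
    · simp only [h, if_false]; exact H.pos r hr
  · intro r hr
    by_cases h : r = r₀
    · simp only [h, if_true]; exact hu0
    · simp only [h, if_false]; exact he2 r hr
  · intro r hr p hp hd
    by_cases h : r = r₀
    · simp only [h, if_true] at hd
      rcases (Nat.Prime.dvd_mul hp).1 hd with hd | hd
      · exact mem_insert_of_mem (H.smooth r₀ hr₀ p hp hd)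
      · rw [(Nat.prime_dvd_prime_iff_eq hp hq).1 hd]; exact mem_insert_self _ _
    · simp only [h, if_false] at hd
      exact mem_insert_of_mem (H.smooth r hr p hp hd)
  · intro r hr p hp hd
    by_cases h : r = r₀
    · simp only [h, if_true] at hd
      rcases mem_insert.1 hp with rfl | hp
      · exact hqu hd
      · exact he3 r₀ hr₀ p hp (by rw [her₀]; exact hd.mul_left _)
    · simp only [h, if_false] at hd
      rcases mem_insert.1 hp with rfl | hp
      · exact hqe r hr h hd
      · exact he3 r hr p hp hd
  · intro r hr hd
    by_cases h : r = r₀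
    · simp only [h, if_true] at hd
      refine H.bounded r₀ hr₀ (Nat.Coprime.dvd_of_dvd_mul_right (Nat.Coprime.pow_left k ?_) hd)
      exact (Nat.coprime_primes hℓ hq).2 fun h => hqQ (h ▸ H.mem)
    · simp only [h, if_false] at hd
      exact H.bounded r hr hd
  · simp only [if_true]
    intro hu1
    refine hqℓ3 ?_
    have h2 : q * u ≡ 1 [MOD ℓ ^ 3] := by rw [← her₀]; exact (he4 r₀ hr₀).trans h1
    have h3 : q * u ≡ q * 1 [MOD ℓ ^ 3] := hu1.mul_left q
    rw [mul_one] at h3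
    exact h3.symm.trans h2
  · intro r hr hne
    simp only [hne, if_false]
    exact he4 r hr

/-- There is a base point at which no rough part is congruent to `1` modulo `ℓ ^ 3`. -/
theorem exists_smoothRoughValues_not_modEq_one {k ℓ : ℕ} {R : Finset ℚ} (hR : #R ≤ k)
    (hℓ : ℓ.Prime) {Q₀ : Finset ℕ} (hQ₀ : ∀ p ∈ Q₀, p.Prime) (hℓQ : ℓ ∈ Q₀) :
    ∃ Q n₀ b c, Q₀ ⊆ Q ∧ SmoothRoughValues k ℓ R Q n₀ b c ∧
      (∀ r ∈ R, ¬ c r ≡ 1 [MOD ℓ ^ 3]) ∧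
      ∑ p ∈ Q, padicValNat ℓ (p - 1) ≤ ∑ p ∈ Q₀, padicValNat ℓ (p - 1) + #R := by
  suffices h : ∀ R' ⊆ R, ∃ Q n₀ b c, Q₀ ⊆ Q ∧ SmoothRoughValues k ℓ R Q n₀ b c ∧
      (∀ r ∈ R', ¬ c r ≡ 1 [MOD ℓ ^ 3]) ∧
      ∑ p ∈ Q, padicValNat ℓ (p - 1) ≤ ∑ p ∈ Q₀, padicValNat ℓ (p - 1) + #R' from h R subset_rfl
  intro R'
  induction R' using Finset.induction_on with
  | empty =>
    intro _
    obtain ⟨n₀, b, c, H⟩ := exists_smoothRoughValues hR hℓ hQ₀ hℓQ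
    exact ⟨Q₀, n₀, b, c, subset_rfl, H, by simp, by simp⟩
  | insert r₀ R' hnot ih =>
    intro hsub
    obtain ⟨Q, n₀, b, c, hQ, H, h1, h2⟩ := ih ((subset_insert _ _).trans hsub)
    have hr₀ : r₀ ∈ R := hsub (mem_insert_self _ _)
    rw [card_insert_of_notMem hnot]
    by_cases hc : c r₀ ≡ 1 [MOD ℓ ^ 3]
    · obtain ⟨q, n₀', b', c', hqQ, hv, H', hc', hother⟩ := H.exists_insert hr₀ hc
      refine ⟨insert q Q, n₀', b', c', hQ.trans (subset_insert _ _), H', fun r hr => ?_, ?_⟩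
      · rcases mem_insert.1 hr with rfl | hr
        · exact hc'
        · have hne : r ≠ r₀ := fun h => hnot (h ▸ hr)
          exact fun h => h1 r hr
            ((hother r (hsub (mem_insert_of_mem hr)) hne).symm.trans h)
      · rw [sum_insert hqQ]; omega
    · refine ⟨Q, n₀, b, c, hQ, H, fun r hr => ?_, by omega⟩
      rcases mem_insert.1 hr with rfl | hr
      · exact hc
      · exact h1 r hr

/-! ### A scale on which the primes congruent to `1` are sparse -/

/-- On a suitable logarithmic scale, the primes congruent to `1` modulo `q` are as sparse as
expected. -/
lemma exists_window {q : ℕ} [NeZero q] {T : ℕ} (hT : 2 ≤ T) (B₀ : ℕ) : ∃ B, B₀ ≤ B ∧ 0 < B ∧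
    ∀ S : Finset ℕ, (∀ p ∈ S, p.Prime ∧ (p : ZMod q) = 1 ∧ 2 ^ B < p ∧ p ≤ 2 ^ (T * B)) →
      ∑ p ∈ S, (p : ℝ)⁻¹ ≤ (Real.log T + 1) / q.totient := by
  by_contra! hcon
  obtain ⟨C, hC⟩ := exists_sum_inv_prime_le (q := q) (a := 1) isUnit_one
  -- Consecutive windows are disjoint. If all were overfull, their excess of `1 / φ(q)` each would
  -- accumulate beyond the constant `C` of the Mertens bound.
  set b : ℕ → ℕ := fun i => (B₀ + 1) * T ^ i with hb
  have hT0 : 0 < T := by omega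
  have hb0 : ∀ i, 0 < b i := fun i => Nat.mul_pos (by omega) (pow_pos hT0 i)
  have hbB : ∀ i, B₀ ≤ b i := fun i => by
    have := Nat.le_mul_of_pos_right (B₀ + 1) (pow_pos hT0 i)
    simp only [hb]; omega
  choose S hS1 hS2 using fun i => hcon (b i) (hbB i) (hb0 i)
  have hsucc : ∀ i, T * b i = b (i + 1) := fun i => by simp only [hb, pow_succ]; ring
  have hmono : Monotone b := monotone_nat_of_le_succ fun i => by
    rw [← hsucc]; exact Nat.le_mul_of_pos_left _ hT0
  have hdisj : ∀ i j, i < j → Disjoint (S i) (S j) := fun i j hij => by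
    refine disjoint_left.2 fun p hpi hpj => ?_
    have h1 := (hS1 i p hpi).2.2.2
    have h2 := (hS1 j p hpj).2.2.1
    rw [hsucc] at h1
    have h3 := Nat.pow_le_pow_right (n := 2) two_pos (hmono (Nat.succ_le_of_lt hij))
    have h4 : b i.succ = b (i + 1) := rfl
    rw [h4] at h3
    omega
  have hq : (0 : ℝ) < q.totient := by exact_mod_cast Nat.totient_pos.2 (NeZero.pos q)
  have key : ∀ n : ℕ, (n : ℝ) ≤ Real.log (B₀ + 1) + C * q.totient := fun n => by
    have hpair : Set.PairwiseDisjoint (range n : Set ℕ) S := fun i _ j _ hij => by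
      rcases lt_or_gt_of_ne hij with h | h
      · exact hdisj i j h
      · exact (hdisj j i h).symm
    have h1 := hC (b n) ((range n).biUnion S) (hb0 n) fun p hp => by
      obtain ⟨i, hi, hpi⟩ := mem_biUnion.1 hp
      obtain ⟨a1, a2, -, a4⟩ := hS1 i p hpi
      rw [hsucc] at a4
      exact ⟨a1, a2, a4.trans (Nat.pow_le_pow_right two_pos (hmono (mem_range.1 hi)))⟩
    rw [sum_biUnion hpair] at h1
    have h2 : ∑ _i ∈ range n, (Real.log T + 1) / q.totient ≤
        ∑ i ∈ range n, ∑ p ∈ S i, (p : ℝ)⁻¹ := sum_le_sum fun i _ => (hS2 i).le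
    have h3 : Real.log (b n) = Real.log (B₀ + 1) + n * Real.log T := by
      simp only [hb]
      push_cast
      rw [Real.log_mul (by positivity) (by positivity), Real.log_pow]
    rw [sum_const, card_range, nsmul_eq_mul] at h2
    have h4 := h2.trans h1
    rw [h3, mul_div_assoc', div_add' _ _ _ hq.ne', div_le_div_iff_of_pos_right hq] at h4
    linarith
  obtain ⟨n, hn⟩ := exists_nat_gt (Real.log (B₀ + 1) + C * q.totient)
  exact absurd (key n) (not_le.2 hn)

/-! ### Comparison of densities at two sifting limits -/

section DensityBounds

variable {h : ℕ → ℝ}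

lemma sum_Ioc_two_pow_le {c : ℝ} (h0 : ∀ m, 0 ≤ h m) {A : ℕ} (B : ℕ)
    (hmass : ∀ i : ℕ, i * ∑ p ∈ Icc 1 (2 ^ A) with Nat.clog 2 p = i, h p ≤ c) :
    ∑ m ∈ Ioc (2 ^ B) (2 ^ A), h m ≤ ∑ i ∈ Ioc B A, c * (i : ℝ)⁻¹ := by
  have hmaps : ∀ m ∈ Ioc (2 ^ B) (2 ^ A), Nat.clog 2 m ∈ Ioc B A := fun m hm => by
    have hm := mem_Ioc.1 hm
    exact mem_Ioc.2 ⟨(Nat.lt_clog_iff_pow_lt one_lt_two).2 hm.1,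
      (Nat.clog_le_iff_le_pow one_lt_two).2 hm.2⟩
  rw [← sum_fiberwise_of_maps_to hmaps]
  refine sum_le_sum fun i hi => ?_
  have hi0 : (0 : ℝ) < i := by exact_mod_cast (by have := mem_Ioc.1 hi; omega : 0 < i)
  rw [← div_eq_mul_inv, le_div_iff₀ hi0, mul_comm]
  refine le_trans (mul_le_mul_of_nonneg_left ?_ hi0.le) (hmass i)
  refine sum_le_sum_of_subset_of_nonneg (fun m hm => ?_) fun m _ _ => h0 m
  simp only [mem_filter, mem_Ioc, mem_Icc] at hm ⊢
  have h2B : 0 < 2 ^ B := by positivity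
  exact ⟨⟨h2B.trans hm.1.1, hm.1.2⟩, hm.2⟩

lemma sum_Icc_two_pow_le {c : ℝ} (h0 : ∀ m, 0 ≤ h m) (hone : h 1 = 0) {A : ℕ}
    (hmass : ∀ i : ℕ, i * ∑ p ∈ Icc 1 (2 ^ A) with Nat.clog 2 p = i, h p ≤ c) (hc : 0 ≤ c) :
    ∑ m ∈ Icc 1 (2 ^ A), h m ≤ c * (1 + Real.log A) := by
  have h1 := sum_Ioc_two_pow_le h0 0 hmass
  rw [pow_zero, ← mul_sum] at h1
  rw [← add_sum_Ioc_eq_sum_Icc (f := h) (Nat.one_le_two_pow (n := A)), hone, zero_add]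
  have h2 := harmonic_le_one_add_log A
  rw [harmonic_eq_sum_Icc] at h2
  push_cast at h2
  exact h1.trans (mul_le_mul_of_nonneg_left h2 hc)

lemma sum_Ioc_inv_le {B : ℕ} (hB : 0 < B) (s : ℕ) :
    ∑ i ∈ Ioc B (s * B), (i : ℝ)⁻¹ ≤ s := by
  have hB' : (0 : ℝ) < B := by exact_mod_cast hB
  have h1 : ∀ i ∈ Ioc B (s * B), (i : ℝ)⁻¹ ≤ (B : ℝ)⁻¹ := fun i hi =>
    inv_anti₀ hB' (by exact_mod_cast (mem_Ioc.1 hi).1.le)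
  refine (sum_le_card_nsmul _ _ _ h1).trans ?_
  rw [Nat.card_Ioc, nsmul_eq_mul, ← div_eq_mul_inv, div_le_iff₀ hB']
  exact_mod_cast Nat.sub_le _ _

lemma one_le_one_sub_mul_exp {x : ℝ} (h0 : 0 ≤ x) (h1 : x ≤ 1 / 2) :
    1 ≤ (1 - x) * Real.exp (2 * x) := by
  have h2 := Real.add_one_le_exp (2 * x)
  nlinarith [mul_le_mul_of_nonneg_left h2 (by linarith : 0 ≤ 1 - x),
    mul_nonneg h0 (by linarith : 0 ≤ 1 / 2 - x)]

lemma siftedDensity_le_mul_exp (h0 : ∀ m, 0 ≤ h m) (h1 : ∀ m, h m ≤ 1 / 2) {M N : ℕ}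
    (hMN : M ≤ N) :
    siftedDensity h M ≤ siftedDensity h N * Real.exp (2 * ∑ m ∈ Ioc M N, h m) := by
  have e : siftedDensity h N = siftedDensity h M * ∏ m ∈ Ioc M N, (1 - h m) := by
    simp only [siftedDensity]
    rw [show Icc 1 N = Ioc 0 N from rfl, show Icc 1 M = Ioc 0 M from rfl,
      prod_Ioc_consecutive _ (Nat.zero_le M) hMN]
  rw [e, mul_assoc, mul_sum, Real.exp_sum, ← prod_mul_distrib]
  refine le_mul_of_one_le_right (siftedDensity_pos h1 M).le ?_
  exact one_le_prod fun m _ => one_le_one_sub_mul_exp (h0 m) (h1 m)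

end DensityBounds

/-! ### Arbitrary dimension: avoiding small primes and sparse medium-sized primes -/

section LargeDimension

variable {P : Set ℕ} {R : Finset ℚ} {W n₀ : ℕ}

/-- The upper sieve bounds the number of sifted integers that are hit by one more prime. -/
lemma sum_residueHit_mul_upperSieve_le (hP : ∀ p ∈ P, p.Prime ∧ ¬ p ∣ W) {β : ℕ} (hβ : 1 ≤ β)
    (x : ℕ) {p N : ℕ} (hp : p ∈ P) (hpN : N < p) (j : ℕ)
    (hU : 0 ≤ upperSieve β (residueDensity (formResidues P R W n₀)) N j) :
    ∑ t ∈ range x with t ≡ 0 [MOD 1], residueHit (formResidues P R W n₀) t p *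
      upperSieve β (residueHit (formResidues P R W n₀) t) N j ≤
        #R * (x * (p : ℝ)⁻¹ * upperSieve β (residueDensity (formResidues P R W n₀)) N j +
          sieveRemainder (formResidues P R W n₀) N j) := by
  set Ω := formResidues P R W n₀
  have hpp := (hP p hp).1
  rw [sum_modEq_residueHit_mul (Ω := Ω) lt_of_mem_formResidues (Nat.coprime_one_left p)]
  have hterm : ∀ ω ∈ Ω p,
      ∑ t ∈ range x with t ≡ Nat.chineseRemainder (Nat.coprime_one_left p) 0 ω [MOD 1 * p],
        upperSieve β (residueHit Ω t) N j ≤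
          x * (p : ℝ)⁻¹ * upperSieve β (residueDensity Ω) N j + sieveRemainder Ω N j := by
    intro ω _
    have h1 := (abs_sum_sieve_sub_le (Ω := Ω) lt_of_mem_formResidues
      (coprime_of_formResidues_nonempty hP) hβ x N j (1 * p)
      (Nat.chineseRemainder (Nat.coprime_one_left p) 0 ω) (by rw [one_mul]; exact hpp.pos)
      fun p' hp' hne => by
        rw [one_mul]
        exact (Nat.coprime_primes hpp (hP p' (mem_of_formResidues_nonempty hne)).1).2
          (by omega)).1
    have h2 := (abs_le.1 h1).2
    rw [one_mul, div_eq_mul_inv] at h2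
    rw [one_mul]
    linarith
  refine (sum_le_sum hterm).trans ?_
  rw [sum_const, nsmul_eq_mul]
  refine mul_le_mul_of_nonneg_right (by exact_mod_cast card_formResidues_le hP p) ?_
  have := sieveRemainder_nonneg Ω N j
  positivity

/-- If every integer below `x` is hit by a small prime or by a prime in `S`, then the lower
sieve is at most the sum of the upper sieves over the hits by primes in `S`. -/
lemma lowerSieve_le_sum_residueHit_mul_upperSieve {Ω : ℕ → Finset ℕ} {β t M N i j : ℕ}
    (hMN : M ≤ N) {S : Finset ℕ}
    (hhit : (∃ p ∈ Icc 1 N, t % p ∈ Ω p) ∨ ∃ p ∈ S, t % p ∈ Ω p) :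
    lowerSieve β (residueHit Ω t) N i ≤
      ∑ p ∈ S, residueHit Ω t p * upperSieve β (residueHit Ω t) M j := by
  have h0 : ∀ m, 0 ≤ residueHit Ω t m := fun m => by unfold residueHit; split_ifs <;> norm_num
  have h1 : ∀ m, residueHit Ω t m ≤ 1 := fun m => by unfold residueHit; split_ifs <;> norm_num
  have hV := (lowerSieve_le_siftedDensity_le_upperSieve β h0 h1 N i).1
  have hU := (lowerSieve_le_siftedDensity_le_upperSieve β h0 h1 M j).2
  have hU0 := (siftedDensity_nonneg h1 M).trans hU
  refine hV.trans ?_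
  rcases hhit with ⟨p, hp, hhit⟩ | ⟨p, hp, hhit⟩
  · have : siftedDensity (residueHit Ω t) N = 0 := prod_eq_zero hp (by simp [residueHit, hhit])
    rw [this]
    exact sum_nonneg fun p _ => mul_nonneg (h0 p) hU0
  · have h3 : siftedDensity (residueHit Ω t) N ≤ siftedDensity (residueHit Ω t) M :=
      prod_le_prod_of_subset_of_le_one (Icc_subset_Icc_right hMN)
        (fun m _ => by linarith [h1 m]) fun m _ _ => by linarith [h0 m]
    refine (h3.trans hU).trans ?_
    have h4 := single_le_sum (f := fun p => residueHit Ω t p * upperSieve β (residueHit Ω t) M j)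
      (fun p _ => mul_nonneg (h0 p) hU0) hp
    simpa [residueHit, hhit] using h4

/-- In arbitrary dimension, the values of linear forms simultaneously avoid the small primes, as
well as the medium-sized primes congruent to `1` modulo `q`, provided that these are sparse. -/
theorem exists_linForm_avoid_small_primes {k q B σ U : ℕ} {μ : ℝ}
    (hP : ∀ p ∈ P, p.Prime ∧ ¬ p ∣ W) (hP2 : ∀ p ∈ P, 2 * #R ≤ p) (hR : #R ≤ k)
    (hσ : σ = 160 * k + 3) (hU : U + 3 * σ = 8 * σ ^ 2 + 1) (hB : 0 < B)
    (hwindow : ∀ S : Finset ℕ, (∀ p ∈ S, p.Prime ∧ (p : ZMod q) = 1 ∧ 2 ^ B < p ∧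
      p ≤ 2 ^ ((8 * σ ^ 2 + 1) * B)) → ∑ p ∈ S, (p : ℝ)⁻¹ ≤ μ)
    (hμ : 2 * k * Real.exp (64 * k * σ) * μ ≤ 1 / 8)
    (hlarge : 16 * (k + 1) * Real.exp (16 * k * (1 + Real.log ((4 * σ * B : ℕ) : ℝ)) + 4 * k ^ 2) ≤
      2 ^ B) :
    ∃ t < 2 ^ ((8 * σ ^ 2 + 1) * B), ∀ r ∈ R, ∀ p ∈ P,
      (p ≤ 2 ^ (4 * σ * B) ∨ (p : ZMod q) = 1 ∧ p ≤ 2 ^ (U * B)) →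
        ¬ (p : ℤ) ∣ linForm r ((W * t + n₀ : ℕ) : ℤ) := by
  classical
  by_contra! hcon
  set A := 4 * σ * B with hA
  have hσ0 : 0 < σ := by omega
  have hA0 : 0 < A := by positivity
  have hBA : B ≤ A := Nat.le_mul_of_pos_left B (by omega)
  set x := 2 ^ ((8 * σ ^ 2 + 1) * B) with hx
  set Ω := formResidues P R W n₀ with hΩ
  set g := residueDensity Ω with hg
  have g0 : ∀ m, 0 ≤ g m := residueDensity_nonneg Ω
  have g1 : ∀ m, g m ≤ 1 / 2 := residueDensity_formResidues_le_half hP hP2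
  have gone : g 1 = 0 := residueDensity_formResidues_eq_zero fun h => Nat.not_prime_one (hP 1 h).1
  have hRk : (#R : ℝ) ≤ k := by exact_mod_cast hR
  have hk0 : (0 : ℝ) ≤ k := Nat.cast_nonneg k
  have hc : (0 : ℝ) ≤ 8 * k := by positivity
  have hmass : ∀ N i : ℕ, i * ∑ p ∈ Icc 1 N with Nat.clog 2 p = i, g p ≤ 8 * k :=
    fun N i => (clog_mass_formResidues_le hP N i).trans (by linarith)
  -- The dyadic masses are at most `c = 8 * k`, and the fundamental lemma needs `20 * c + 1 ≤ β`.
  set β := 160 * k + 2 with hβ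
  have hβ' : 20 * (8 * (k : ℝ)) + 1 ≤ (β : ℕ) := by rw [hβ]; push_cast; linarith
  have hβσ : 2 * β + 2 = 2 * σ := by omega
  have hFA := (fundamental_lemma (β := β) (by omega) g0 g1 gone hc hβ' hA0 (hmass _)
    (le_refl ((2 * β + 2) * A))).2
  -- For hits by primes up to `2 ^ (U * B)` the range `x` leaves room only for a level of order `2 ^
  -- (2 * σ * B)`, so this upper sieve stops at `2 ^ B`.
  have hFB := (fundamental_lemma (β := β) (by omega) g0 g1 gone hc hβ' hB (hmass _)
    (le_refl ((2 * β + 2) * B))).1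
  have hβ1 : 1 ≤ β := by omega
  set S := (Ioc (2 ^ A) (2 ^ (U * B))).filter fun p => p ∈ P ∧ (p : ZMod q) = 1 with hS
  have hSP : ∀ p ∈ S, p ∈ P ∧ 2 ^ A < p := fun p hp =>
    ⟨(mem_filter.1 hp).2.1, (mem_Ioc.1 (mem_filter.1 hp).1).1⟩
  have hBA' : 2 ^ B ≤ 2 ^ A := Nat.pow_le_pow_right two_pos hBA
  have hUx : U ≤ 8 * σ ^ 2 + 1 := by omega
  have hSsum : ∑ p ∈ S, (p : ℝ)⁻¹ ≤ μ := hwindow S fun p hp => by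
    obtain ⟨h1, h2, h3⟩ := mem_filter.1 hp
    have h1 := mem_Ioc.1 h1
    exact ⟨(hP p h2).1, h3, hBA'.trans_lt h1.1,
      h1.2.trans (Nat.pow_le_pow_right two_pos (Nat.mul_le_mul_right B hUx))⟩
  have hScard : (#S : ℝ) ≤ 2 ^ (U * B) := by
    have h1 := card_filter_le (Ioc (2 ^ A) (2 ^ (U * B))) fun p => p ∈ P ∧ (p : ZMod q) = 1
    rw [Nat.card_Ioc] at h1
    exact_mod_cast h1.trans (Nat.sub_le _ _)
  set VA := siftedDensity g (2 ^ A) with hVA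
  set E := Real.exp (16 * k * (1 + Real.log (A : ℝ)) + 4 * k ^ 2) with hE
  have hVA0 : 0 < VA := siftedDensity_pos g1 _
  have hΓA : dualDensity g (2 ^ A) ≤ VA * E := by
    refine (dualDensity_le_siftedDensity_mul_exp g0 g1 _).trans
      (mul_le_mul_of_nonneg_left (Real.exp_le_exp.2 ?_) hVA0.le)
    have h1 := sum_Icc_two_pow_le g0 gone (hmass (2 ^ A)) hc
    have h2 : ∑ m ∈ Icc 1 (2 ^ A), g m ^ 2 ≤ (#R : ℝ) ^ 2 * 2 := sum_residueDensity_sq_le hP _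
    have h3 : (#R : ℝ) ^ 2 ≤ k ^ 2 := pow_le_pow_left₀ (Nat.cast_nonneg _) hRk 2
    linarith
  have hΓB : dualDensity g (2 ^ B) ≤ VA * E := (dualDensity_mono g0 hBA').trans hΓA
  -- Sifting only to `2 ^ B` costs a factor depending on `k` alone; the sparsity assumption `hμ`
  -- compensates for it.
  have hVB : siftedDensity g (2 ^ B) ≤ VA * Real.exp (64 * k * σ) := by
    refine (siftedDensity_le_mul_exp g0 g1 hBA').trans
      (mul_le_mul_of_nonneg_left (Real.exp_le_exp.2 ?_) hVA0.le)
    have h1 := sum_Ioc_two_pow_le g0 B (hmass (2 ^ A))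
    have h2 := sum_Ioc_inv_le hB (4 * σ)
    rw [← mul_sum] at h1
    push_cast at h2
    have h3 := mul_le_mul_of_nonneg_left h2 hc
    linarith
  have hlower : ∀ t ∈ (range x).filter (· ≡ 0 [MOD 1]),
      lowerSieve β (residueHit Ω t) (2 ^ A) ((2 * β + 2) * A) ≤
        ∑ p ∈ S, residueHit Ω t p * upperSieve β (residueHit Ω t) (2 ^ B) ((2 * β + 2) * B) := by
    intro t ht
    refine lowerSieve_le_sum_residueHit_mul_upperSieve hBA' ?_
    obtain ⟨r, hr, p, hp, hsize, hdvd⟩ := hcon t (mem_range.1 (mem_filter.1 ht).1)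
    have hp0 := (hP p hp).1.pos
    have hhit := (mod_mem_formResidues_iff hp hp0).2 ⟨r, hr, hdvd⟩
    by_cases hpA : p ≤ 2 ^ A
    · exact Or.inl ⟨p, mem_Icc.2 ⟨hp0, hpA⟩, hhit⟩
    · obtain ⟨h1, h2⟩ := hsize.resolve_left hpA
      exact Or.inr ⟨p, mem_filter.2 ⟨mem_Ioc.2 ⟨not_le.1 hpA, h2⟩, hp, h1⟩, hhit⟩
  have hsum := sum_le_sum hlower
  rw [sum_comm] at hsum
  have hUp : 0 ≤ upperSieve β g (2 ^ B) ((2 * β + 2) * B) :=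
    (siftedDensity_pos g1 _).le.trans (lowerSieve_le_siftedDensity_le_upperSieve β g0
      (fun m => (g1 m).trans (by norm_num)) _ _).2
  have hdist := (abs_le.1 (abs_sum_sieve_sub_le (Ω := Ω) lt_of_mem_formResidues
    (coprime_of_formResidues_nonempty hP) hβ1 x (2 ^ A) ((2 * β + 2) * A) 1 0 one_pos
    fun p _ _ => Nat.coprime_one_left p).2).1
  rw [Nat.cast_one, div_one] at hdist
  have hremA := (sieveRemainder_le_two_pow_mul Ω (2 ^ A) ((2 * β + 2) * A)).trans
    (mul_le_mul_of_nonneg_left hΓA (by positivity))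
  have hremB := (sieveRemainder_le_two_pow_mul Ω (2 ^ B) ((2 * β + 2) * B)).trans
    (mul_le_mul_of_nonneg_left hΓB (by positivity))
  set τA := sieveRemainder Ω (2 ^ A) ((2 * β + 2) * A)
  set τB := sieveRemainder Ω (2 ^ B) ((2 * β + 2) * B)
  have hτB0 : 0 ≤ τB := sieveRemainder_nonneg Ω _ _
  have hx0 : (0 : ℝ) < x := by rw [hx]; positivity
  have hright : ∑ p ∈ S, ∑ t ∈ range x with t ≡ 0 [MOD 1], residueHit Ω t p *
      upperSieve β (residueHit Ω t) (2 ^ B) ((2 * β + 2) * B) ≤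
        x * VA / 8 + 2 ^ (U * B) * (k * τB) := by
    have h1 : ∀ p ∈ S, ∑ t ∈ range x with t ≡ 0 [MOD 1], residueHit Ω t p *
        upperSieve β (residueHit Ω t) (2 ^ B) ((2 * β + 2) * B) ≤
          (p : ℝ)⁻¹ * (x * (2 * k * Real.exp (64 * k * σ)) * VA) + k * τB := by
      intro p hp
      have h1 := sum_residueHit_mul_upperSieve_le hP hβ1 x (hSP p hp).1
        (hBA'.trans_lt (hSP p hp).2) ((2 * β + 2) * B) hUp
      have h2 : upperSieve β g (2 ^ B) ((2 * β + 2) * B) ≤ 2 * (VA * Real.exp (64 * k * σ)) :=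
        hFB.trans (mul_le_mul_of_nonneg_left hVB zero_le_two)
      have h3 : (0 : ℝ) ≤ x * (p : ℝ)⁻¹ := by positivity
      have h4 : 0 ≤ x * (p : ℝ)⁻¹ * (2 * (VA * Real.exp (64 * k * σ))) + τB := by positivity
      have h5 := mul_le_mul_of_nonneg_left h2 h3
      have h6 := mul_le_mul hRk (add_le_add_left h5 τB)
        (by have := mul_nonneg h3 hUp; linarith) hk0
      refine (h1.trans h6).trans (le_of_eq ?_)
      ring
    refine (sum_le_sum h1).trans ?_
    rw [sum_add_distrib, ← sum_mul, sum_const, nsmul_eq_mul]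
    refine add_le_add ?_ (mul_le_mul_of_nonneg_right hScard (by positivity))
    have h2 := mul_le_mul_of_nonneg_right hSsum
      (by positivity : 0 ≤ x * (2 * k * Real.exp (64 * k * σ)) * VA)
    have h3 := mul_le_mul_of_nonneg_left hμ (by positivity : 0 ≤ x * VA)
    linarith
  have hE0 : 0 < E := Real.exp_pos _
  have hpowA : (2 * β + 2) * A = 8 * σ ^ 2 * B := by rw [hβσ, hA]; ring
  have hxA : (x : ℝ) = 2 ^ ((2 * β + 2) * A) * 2 ^ B := by
    rw [hpowA, ← pow_add, hx]; push_cast; congr 1; ring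
  have hxB : (x : ℝ) = 2 ^ (U * B) * 2 ^ ((2 * β + 2) * B) * 2 ^ (σ * B) := by
    rw [hβσ, ← pow_add, ← pow_add, hx, ← hU]; push_cast; congr 1; ring
  have hBσ : (2 : ℝ) ^ B ≤ 2 ^ (σ * B) :=
    pow_le_pow_right₀ one_le_two (Nat.le_mul_of_pos_left B hσ0)
  have hτA : 16 * τA ≤ x * VA := by
    have h1 : 16 * E ≤ 2 ^ B := by nlinarith
    have h2 := mul_le_mul_of_nonneg_left h1 (by positivity : 0 ≤ 2 ^ ((2 * β + 2) * A) * VA)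
    rw [hxA]
    linarith
  have hτB : 16 * (2 ^ (U * B) * (k * τB)) ≤ x * VA := by
    have h1 : 16 * (k * E) ≤ 2 ^ (σ * B) := by nlinarith
    have h2 := mul_le_mul_of_nonneg_left h1
      (by positivity : 0 ≤ 2 ^ (U * B) * 2 ^ ((2 * β + 2) * B) * VA)
    have h3 := mul_le_mul_of_nonneg_left hremB (by positivity : (0 : ℝ) ≤ 16 * 2 ^ (U * B) * k)
    rw [hxB]
    linarith
  -- The main term is at least `x * VA / 2`, while the union bound and the two remainders take at
  -- most `1/8 + 1/16 + 1/16` of `x * VA`.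
  have hmain := mul_le_mul_of_nonneg_left hFA hx0.le
  have := mul_pos hx0 hVA0
  linarith

end LargeDimension

/-! ### Valuations of the sifted values -/

/-- Powers of logarithms are eventually smaller than the exponential. -/
lemma exists_mul_exp_log_le_two_pow (a b c : ℝ) {s : ℕ} (hs : 0 < s) :
    ∃ B₀ : ℕ, ∀ B, B₀ ≤ B → a * Real.exp (b * (1 + Real.log ((s * B : ℕ) : ℝ)) + c) ≤ 2 ^ B := by
  have h1 : Filter.Tendsto (fun B : ℕ => (B : ℝ) ^ b * (1 / 2 : ℝ) ^ B) Filter.atTop (nhds 0) := by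
    have h2 := tendsto_rpow_mul_exp_neg_mul_atTop_nhds_zero b (Real.log 2) (Real.log_pos one_lt_two)
    refine (h2.comp tendsto_natCast_atTop_atTop).congr fun B => ?_
    simp only [Function.comp]
    rw [neg_mul, Real.exp_neg, mul_comm (Real.log 2), Real.exp_nat_mul, Real.exp_log two_pos,
      one_div, inv_pow]
  have h3 := h1.const_mul (|a| * Real.exp (b * (1 + Real.log s) + c))
  rw [mul_zero] at h3
  obtain ⟨B₀, hB₀⟩ := Filter.eventually_atTop.1 (h3.eventually (gt_mem_nhds one_pos))
  refine ⟨B₀ + 1, fun B hB => ?_⟩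
  have h4 := hB₀ B (by omega)
  have hB0 : (0 : ℝ) < B := by exact_mod_cast (by omega : 0 < B)
  have hs0 : (0 : ℝ) < s := by exact_mod_cast hs
  have h5 : Real.exp (b * (1 + Real.log ((s * B : ℕ) : ℝ)) + c) =
      Real.exp (b * (1 + Real.log s) + c) * (B : ℝ) ^ b := by
    rw [Real.rpow_def_of_pos hB0, ← Real.exp_add]
    push_cast
    rw [Real.log_mul hs0.ne' hB0.ne']
    congr 1
    ring
  rw [h5]
  rw [one_div, inv_pow, ← mul_assoc, ← div_eq_mul_inv, div_lt_one (by positivity)] at h4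
  refine le_trans ?_ h4.le
  rw [mul_assoc]
  exact mul_le_mul_of_nonneg_right (le_abs_self a) (by positivity)

/-- A rough number that is not much larger than the primes congruent to `1` modulo `ℓ ^ e` that
may divide it has few prime divisors `p`, and `p - 1` has small valuation at `ℓ`. -/
lemma sum_primeFactors_padicValNat_pred_le {ℓ e c c₀ X Y K : ℕ} [Fact ℓ.Prime] (he : 0 < e) (hc0 : 0 < c)
    (hrough : ∀ p : ℕ, p.Prime → p ∣ c → Y < p)
    (hlarge : ∀ p : ℕ, p.Prime → p ∣ c → (p : ZMod (ℓ ^ e)) = 1 → X < p)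
    (hmod : c ≡ c₀ [MOD ℓ ^ 3]) (hc₀ : ¬ c₀ ≡ 1 [MOD ℓ ^ 3]) (hcXY : c ≤ X * Y) (hY : 1 < Y)
    (hK : X * Y ≤ Y ^ K) :
    ∑ p ∈ c.primeFactors, padicValNat ℓ (p - 1) ≤ K * (e + 2) := by
  have hcard : #c.primeFactors ≤ K := by
    have h1 : Y ^ #c.primeFactors ≤ ∏ p ∈ c.primeFactors, p := pow_card_le_prod _ _ _ fun p hp =>
      (hrough p (Nat.prime_of_mem_primeFactors hp) (Nat.dvd_of_mem_primeFactors hp)).le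
    exact (Nat.pow_le_pow_iff_right hY).1
      (((h1.trans (Nat.le_of_dvd hc0 (Nat.prod_primeFactors_dvd c))).trans hcXY).trans hK)
  have hval : ∀ m p : ℕ, p.Prime → ¬ p ≡ 1 [MOD ℓ ^ m] → padicValNat ℓ (p - 1) ≤ m :=
    fun m p hp hne => by
      by_contra! h
      exact hne ((Nat.modEq_iff_dvd' hp.one_le).2
        ((pow_dvd_pow ℓ h.le).trans pow_padicValNat_dvd)).symm
  have hone : ∀ p ∈ c.primeFactors, padicValNat ℓ (p - 1) ≤ e + 2 := fun p hp => by
    have hpp := Nat.prime_of_mem_primeFactors hp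
    have hpc := Nat.dvd_of_mem_primeFactors hp
    by_cases h1 : p ≡ 1 [MOD ℓ ^ e]
    swap
    · exact (hval e p hpp h1).trans (by omega)
    have hXp := hlarge p hpp hpc (by simpa using (ZMod.natCast_eq_natCast_iff p 1 _).2 h1)
    -- A cofactor other than `1` would have a prime factor above `Y`, which would force `c > X * Y`.
    have hpc' : p = c := by
      obtain ⟨m, hm⟩ := hpc
      by_cases hm1 : m = 1
      · rw [hm, hm1, mul_one]
      obtain ⟨p', hp', hd⟩ := Nat.exists_prime_and_dvd hm1
      have h2 := hrough p' hp' (hm ▸ Dvd.dvd.mul_left hd p)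
      have hm0 : 0 < m := Nat.pos_of_ne_zero fun h => by simp [h] at hm; omega
      have h3 := Nat.le_of_dvd hm0 hd
      exact absurd (hm ▸ hcXY) (not_le.2 (Nat.mul_lt_mul'' hXp (h2.trans_le h3)))
    rw [hpc']
    exact (hval 3 c (hpc' ▸ hpp) fun h => hc₀ (hmod.symm.trans h)).trans (by omega)
  exact (sum_le_card_nsmul _ _ _ hone).trans (Nat.mul_le_mul_right _ hcard)

lemma sum_biUnion_le_sum {ι : Type*} (R : Finset ι) (S : ι → Finset ℕ) (v : ℕ → ℕ) :
    ∑ p ∈ R.biUnion S, v p ≤ ∑ r ∈ R, ∑ p ∈ S r, v p := by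
  classical
  induction R using Finset.induction_on with
  | empty => simp
  | insert r R hr ih =>
    rw [biUnion_insert, sum_insert hr]
    have := sum_union_inter (s₁ := S r) (s₂ := R.biUnion S) (f := v)
    omega

lemma padicValInt_prod_le {ℓ m : ℕ} [hℓ : Fact ℓ.Prime] (R : Multiset ℚ) (g : ℚ → ℤ)
    (h0 : ∀ r ∈ R, g r ≠ 0) (hg : ∀ r ∈ R, padicValInt ℓ (g r) ≤ m) :
    (R.map g).prod ≠ 0 ∧ padicValInt ℓ (R.map g).prod ≤ Multiset.card R * m := by
  induction R using Multiset.induction_on with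
  | empty => simp
  | cons r R ih =>
    obtain ⟨h1, h2⟩ := ih (fun r hr => h0 r (Multiset.mem_cons_of_mem hr))
      fun r hr => hg r (Multiset.mem_cons_of_mem hr)
    have h3 := h0 r (Multiset.mem_cons_self r R)
    have h4 := hg r (Multiset.mem_cons_self r R)
    rw [Multiset.map_cons, Multiset.prod_cons, Multiset.card_cons]
    refine ⟨mul_ne_zero h3 h1, ?_⟩
    rw [padicValInt.mul h3 h1, add_mul, one_mul]
    omega

/-! ### The two halves of the theorem for split polynomials -/

section SplitPolynomial

open Polynomial

variable {f : ℤ[X]}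

lemma card_roots_map_rat_le (f : ℤ[X]) :
    Multiset.card (f.map (Int.castRingHom ℚ)).roots ≤ f.natDegree :=
  (card_roots' _).trans natDegree_map_le

lemma card_toFinset_roots_map_rat_le (f : ℤ[X]) :
    #(f.map (Int.castRingHom ℚ)).roots.toFinset ≤ f.natDegree :=
  (Multiset.toFinset_card_le _).trans (card_roots_map_rat_le f)

lemma totientGcd_dvd {n : ℕ} (hn : 1 ≤ n) : totientGcd f ∣ (f.eval (n : ℤ)).natAbs.totient :=
  Nat.setGcd_dvd_of_mem ⟨n, hn, rfl⟩

theorem not_dvd_totientGcd (hf : f.IsPrimitive) (hs : (f.map (Int.castRingHom ℚ)).Splits) {ℓ : ℕ}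
    (hℓ : ℓ.Prime) (hk : 2 * f.natDegree + 1 < ℓ) : ¬ ℓ ∣ totientGcd f := by
  have : Fact ℓ.Prime := ⟨hℓ⟩
  set R := (f.map (Int.castRingHom ℚ)).roots.toFinset with hR
  have hRk : #R ≤ f.natDegree := card_toFinset_roots_map_rat_le f
  obtain ⟨n₀, -, hn₀⟩ := exists_not_pow_dvd_linForm (B := 1) hRk hℓ (by rw [pow_one]; omega)
  rw [pow_one] at hn₀
  have hshift : ∀ r ∈ R, ∀ t : ℕ, ¬ (ℓ : ℤ) ∣ linForm r ((ℓ * t + n₀ : ℕ) : ℤ) :=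
    fun r hr t h => by
      refine hn₀ r hr ((dvd_iff_dvd_of_dvd_sub ?_).1 h)
      have h1 : (ℓ : ℤ) ∣ ((ℓ * t + n₀ : ℕ) : ℤ) - n₀ := ⟨t, by push_cast; ring⟩
      rw [linForm_sub]
      exact Dvd.dvd.mul_left h1 _
  -- The extra `ℓ * 1` in the base point guarantees `n ≥ 1`.
  obtain ⟨t, ht⟩ := exists_linForm_avoid_primes (n₀ := ℓ * 1 + n₀) hℓ
    (by omega) fun r hr => hshift r hr 1
  have he : ℓ * t + (ℓ * 1 + n₀) = ℓ * (t + 1) + n₀ := by ring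
  rw [he] at ht
  set n := ℓ * (t + 1) + n₀ with hn
  have hn1 : 1 ≤ n := by have := Nat.mul_pos hℓ.pos (Nat.succ_pos t); omega
  have hval : ¬ (ℓ : ℤ) ∣ f.eval (n : ℤ) := fun h => by
    obtain ⟨r, hr, hd⟩ := exists_dvd_linForm_of_dvd_eval hf hs hℓ h
    exact hshift r (Multiset.mem_toFinset.2 hr) (t + 1) hd
  intro hdvd
  have hN0 : (f.eval (n : ℤ)).natAbs ≠ 0 := fun h => hval (by rw [Int.natAbs_eq_zero.1 h]; simp)
  have hφ := hdvd.trans (totientGcd_dvd hn1)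
  have h1 := padicValNat_totient_le (ℓ := ℓ) hN0
  have hv : padicValNat ℓ (f.eval (n : ℤ)).natAbs = 0 :=
    padicValNat.eq_zero_of_not_dvd fun h => hval (Int.natCast_dvd.2 h)
  rw [hv, zero_add] at h1
  have h2 := one_le_padicValNat_of_dvd (Nat.totient_eq_zero.not.2 hN0) hφ
  obtain ⟨p, hp, hp0⟩ := exists_ne_zero_of_sum_ne_zero (by omega :
    ∑ p ∈ (f.eval (n : ℤ)).natAbs.primeFactors, padicValNat ℓ (p - 1) ≠ 0)
  have hpp := Nat.prime_of_mem_primeFactors hp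
  obtain ⟨r, hr, hd⟩ := exists_dvd_linForm_of_dvd_eval hf hs hpp
    (Int.natCast_dvd.2 (Nat.dvd_of_mem_primeFactors hp))
  refine ht r (Multiset.mem_toFinset.2 hr) p hpp ?_ hd
  have h3 : p ≡ 1 [MOD ℓ] :=
    ((Nat.modEq_iff_dvd' hpp.one_le).2 (dvd_of_one_le_padicValNat (by omega))).symm
  simpa using (ZMod.natCast_eq_natCast_iff p 1 ℓ).2 h3

lemma exists_le_totient_pow {ℓ : ℕ} (hℓ : ℓ.Prime) (X : ℝ) :
    ∃ e, 0 < e ∧ X ≤ ((ℓ ^ e).totient : ℝ) := by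
  obtain ⟨m, hm⟩ := exists_nat_gt X
  refine ⟨m + 1, by omega, hm.le.trans ?_⟩
  rw [Nat.totient_prime_pow_succ hℓ]
  have h1 : m < ℓ ^ m := Nat.lt_pow_self hℓ.one_lt
  exact_mod_cast h1.le.trans (Nat.le_mul_of_pos_right _ (by have := hℓ.two_le; omega))

/-- The valuation of the totients of the values is bounded at a suitable positive integer. -/
theorem exists_padicValNat_totient_eval_le (k : ℕ) {ℓ : ℕ} (hℓ : ℓ.Prime) (hk : ℓ ≤ 2 * k + 1) :
    ∃ M : ℕ, ∀ f : ℤ[X], f.IsPrimitive → f.natDegree = k → (f.map (Int.castRingHom ℚ)).Splits →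
      ∃ n : ℕ, 1 ≤ n ∧ f.eval (n : ℤ) ≠ 0 ∧
        padicValNat ℓ (f.eval (n : ℤ)).natAbs.totient ≤ M := by
  have hFact : Fact ℓ.Prime := ⟨hℓ⟩
  set σ := 160 * k + 3 with hσ
  set T := 8 * σ ^ 2 + 1 with hT
  have hUT : 3 * σ ≤ T := by nlinarith
  obtain ⟨U, hU⟩ : ∃ U, U + 3 * σ = T := ⟨T - 3 * σ, by omega⟩
  -- This makes the window bound `(log T + 1) / φ(ℓ ^ e)` small enough for the sieve, with `e`
  -- depending only on `k` and `ℓ`.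
  obtain ⟨e, he0, he⟩ := exists_le_totient_pow hℓ
    (8 * (2 * k * Real.exp (64 * k * σ) * (Real.log T + 1)))
  -- With the primes up to `2 * k + 1` in the smooth part, all sifting densities are at most `1 /
  -- 2`.
  set Q₀ := (range (2 * k + 2)).filter Nat.Prime with hQ₀
  -- The term `k * k` bounds the valuation of the forms with multiplicity, the next two account for
  -- the primes in `Q`, at most one auxiliary prime per form, and the last one for the rough parts.
  refine ⟨k * k + (∑ p ∈ Q₀, padicValNat ℓ (p - 1) + k + k * ((U + 4 * σ) * (e + 2))),
    fun f hf hdeg hs => ?_⟩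
  set R := (f.map (Int.castRingHom ℚ)).roots.toFinset with hR
  have hRk : #R ≤ k := hdeg ▸ card_toFinset_roots_map_rat_le f
  obtain ⟨Q, n₀, b, c, hQ, H, hc, hQsum⟩ := exists_smoothRoughValues_not_modEq_one hRk hℓ
    (Q₀ := Q₀) (fun p hp => (mem_filter.1 hp).2)
    (mem_filter.2 ⟨mem_range.2 (by omega), hℓ⟩)
  set W := stableModulus ℓ R Q b with hW
  have hW0 : 0 < W := H.stableModulus_pos
  set P : Set ℕ := {p | p.Prime ∧ ¬ p ∣ W} with hP
  have hP2 : ∀ p ∈ P, 2 * #R ≤ p := fun p hp => by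
    by_contra! h
    exact hp.2 ((H.prime_dvd_stableModulus_iff hp.1).2
      (hQ (mem_filter.2 ⟨mem_range.2 (by omega), hp.1⟩)))
  obtain ⟨D, -, hD⟩ := exists_abs_linForm_le R W (W * 1 + n₀)
  obtain ⟨B₀, hB₀⟩ := exists_mul_exp_log_le_two_pow (16 * (k + 1)) (16 * k) (4 * k ^ 2)
    (by omega : 0 < 4 * σ)
  have : NeZero (ℓ ^ e) := ⟨pow_ne_zero e hℓ.ne_zero⟩
  -- Taking `B ≥ D` gives `D ≤ 2 ^ (σ * B)`, so the rough parts are at most `2 ^ (U * B) * 2 ^ (4 *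
  -- σ * B)`.
  obtain ⟨B, hB, hB0, hwindow⟩ := exists_window (q := ℓ ^ e) (T := T) (by nlinarith) (B₀ + D)
  have hφ : (0 : ℝ) < (ℓ ^ e).totient := by
    exact_mod_cast Nat.totient_pos.2 (pow_pos hℓ.pos e)
  obtain ⟨t, ht, havoid⟩ := exists_linForm_avoid_small_primes (P := P) (R := R) (W := W)
    (n₀ := W * 1 + n₀) (q := ℓ ^ e) (fun p hp => hp) hP2 hRk hσ hU hB0 hwindow
    (by rw [mul_div_assoc', div_le_iff₀ hφ]; linarith) (hB₀ B (by omega))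
  have hn : W * t + (W * 1 + n₀) = W * (t + 1) + n₀ := by ring
  rw [hn] at havoid
  have hD' : ∀ r ∈ R, |linForm r ((W * (t + 1) + n₀ : ℕ) : ℤ)| ≤ ((D * (t + 1) : ℕ) : ℤ) :=
    fun r hr => hn ▸ hD r hr t
  choose! c' hc'val hc'pos hc'rough hc'mod using
    fun r (hr : r ∈ R) => H.exists_value_eq_rough hr (t + 1)
  rw [← hW] at hc'val
  set n := W * (t + 1) + n₀
  have hn1 : 1 ≤ n := by have := Nat.mul_pos hW0 (Nat.succ_pos t); omega
  have hsize : ∀ r ∈ R, c' r ≤ 2 ^ (U * B) * 2 ^ (4 * σ * B) := fun r hr => by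
    have h1 := hD' r hr
    rw [hc'val r hr, ← Nat.cast_mul, Nat.abs_cast, Nat.cast_le] at h1
    have h2 : c' r ≤ b r * c' r := Nat.le_mul_of_pos_left _ (H.pos r hr)
    have h3 : D ≤ 2 ^ (σ * B) := by
      have h4 : B < 2 ^ B := Nat.lt_two_pow_self
      have h5 : 2 ^ B ≤ 2 ^ (σ * B) :=
        Nat.pow_le_pow_right two_pos (Nat.le_mul_of_pos_left B (by omega))
      omega
    have h4 := (h2.trans h1).trans (Nat.mul_le_mul h3 (Nat.succ_le_of_lt ht))
    refine h4.trans (le_of_eq ?_)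
    rw [← pow_add, ← pow_add, ← hT, ← hU]
    congr 1
    ring
  have hpP : ∀ r ∈ R, ∀ p : ℕ, p.Prime → p ∣ c' r → p ∈ P := fun r hr p hp hd =>
    ⟨hp, fun h => hc'rough r hr p ((H.prime_dvd_stableModulus_iff hp).1 h) hd⟩
  have hdvd : ∀ r ∈ R, ∀ p : ℕ, p ∣ c' r → (p : ℤ) ∣ linForm r n := fun r hr p hd => by
    rw [hc'val r hr]
    exact Dvd.dvd.mul_left (Int.natCast_dvd_natCast.2 hd) _
  have hprimes : ∀ r ∈ R, ∑ p ∈ (c' r).primeFactors, padicValNat ℓ (p - 1) ≤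
      (U + 4 * σ) * (e + 2) := fun r hr => by
    refine sum_primeFactors_padicValNat_pred_le (X := 2 ^ (U * B)) (Y := 2 ^ (4 * σ * B)) he0
      (hc'pos r hr)
      (fun p hp hd => not_le.1 fun h => havoid r hr p (hpP r hr p hp hd) (Or.inl h)
        (hdvd r hr p hd))
      (fun p hp hd h1 => not_le.1 fun h => havoid r hr p (hpP r hr p hp hd) (Or.inr ⟨h1, h⟩)
        (hdvd r hr p hd)) (hc'mod r hr) (hc r hr) (hsize r hr)
      (Nat.one_lt_two_pow (by positivity)) ?_
    rw [← pow_add, ← pow_mul]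
    refine Nat.pow_le_pow_right two_pos ?_
    have h1 : B ≤ 4 * σ * B := Nat.le_mul_of_pos_left B (by omega)
    calc U * B + 4 * σ * B = B * (U + 4 * σ) := by ring
      _ ≤ _ := Nat.mul_le_mul_right _ h1
  have hform : ∀ r ∈ R, linForm r n ≠ 0 ∧ padicValInt ℓ (linForm r n) ≤ k := fun r hr => by
    have hb0 := (H.pos r hr).ne'
    have hc0 := (hc'pos r hr).ne'
    rw [hc'val r hr, ← Nat.cast_mul, padicValInt.of_nat, padicValNat.mul hb0 hc0,
      padicValNat.eq_zero_of_not_dvd (hc'rough r hr ℓ H.mem)]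
    refine ⟨Nat.cast_ne_zero.2 (Nat.mul_ne_zero hb0 hc0), ?_⟩
    have h1 := H.bounded r hr
    rw [padicValNat_dvd_iff_le hb0] at h1
    omega
  obtain ⟨hprod0, hprod⟩ := padicValInt_prod_le (ℓ := ℓ) (m := k)
    (f.map (Int.castRingHom ℚ)).roots (fun r => linForm r n)
    (fun r hr => (hform r (Multiset.mem_toFinset.2 hr)).1)
    fun r hr => (hform r (Multiset.mem_toFinset.2 hr)).2
  have hfdvd := eval_dvd_prod_linForm hf hs (n : ℤ)
  have hf0 : f.eval (n : ℤ) ≠ 0 := fun h => hprod0 (zero_dvd_iff.1 (h ▸ hfdvd))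
  have hN0 := Int.natAbs_ne_zero.2 hf0
  refine ⟨n, hn1, hf0, (padicValNat_totient_le hN0).trans (add_le_add ?_ ?_)⟩
  · have h1 : padicValInt ℓ (f.eval (n : ℤ)) ≤ padicValInt ℓ
        ((f.map (Int.castRingHom ℚ)).roots.map fun r => linForm r n).prod :=
      ((padicValInt_dvd_iff _ _).1 ((padicValInt_dvd _).trans hfdvd)).resolve_left hprod0
    exact (h1.trans hprod).trans
      (Nat.mul_le_mul_right k (hdeg ▸ card_roots_map_rat_le f))
  · classical
    have hsub : (f.eval (n : ℤ)).natAbs.primeFactors ⊆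
        Q ∪ R.biUnion fun r => (c' r).primeFactors := fun p hp => by
      have hpp := Nat.prime_of_mem_primeFactors hp
      obtain ⟨r, hr, hd⟩ := exists_dvd_linForm_of_dvd_eval hf hs hpp
        (Int.natCast_dvd.2 (Nat.dvd_of_mem_primeFactors hp))
      have hr := Multiset.mem_toFinset.2 hr
      rw [hc'val r hr, ← Nat.cast_mul, Int.natCast_dvd_natCast, hpp.dvd_mul] at hd
      rcases hd with hd | hd
      · exact mem_union_left _ (H.smooth r hr p hpp hd)
      · exact mem_union_right _ (mem_biUnion.2
          ⟨r, hr, Nat.mem_primeFactors.2 ⟨hpp, hd, (hc'pos r hr).ne'⟩⟩)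
    have h1 := sum_le_sum_of_subset (f := fun p => padicValNat ℓ (p - 1)) hsub
    have h2 := sum_union_inter (s₁ := Q) (s₂ := R.biUnion fun r => (c' r).primeFactors)
      (f := fun p => padicValNat ℓ (p - 1))
    have h3 := sum_biUnion_le_sum R (fun r => (c' r).primeFactors) fun p => padicValNat ℓ (p - 1)
    have h4 := sum_le_card_nsmul R _ _ hprimes
    rw [smul_eq_mul] at h4
    have h5 := Nat.mul_le_mul_right ((U + 4 * σ) * (e + 2)) hRk
    omega

end SplitPolynomial

theorem theorem2 (k : ℕ) :
    (∀ f : Polynomial ℤ, f.IsPrimitive → f.natDegree = k →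
      (f.map (Int.castRingHom ℚ)).Splits →
      ∀ ℓ : ℕ, ℓ.Prime → 2 * k + 1 < ℓ → ¬ ℓ ∣ totientGcd f) ∧
    (∀ ℓ : ℕ, ℓ.Prime → ℓ ≤ 2 * k + 1 →
      ∃ C : ℕ, ∀ f : Polynomial ℤ, f.IsPrimitive → f.natDegree = k →
        (f.map (Int.castRingHom ℚ)).Splits →
        ∀ e : ℕ, ℓ ^ e ∣ totientGcd f → ℓ ^ e ≤ C) := by
  refine ⟨fun f hf hdeg hs ℓ hℓ hk => not_dvd_totientGcd hf hs hℓ (hdeg ▸ hk),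
    fun ℓ hℓ hk => ?_⟩
  obtain ⟨M, hM⟩ := exists_padicValNat_totient_eval_le k hℓ hk
  refine ⟨ℓ ^ M, fun f hf hdeg hs e he => Nat.pow_le_pow_right hℓ.pos ?_⟩
  obtain ⟨n, hn, h0, hle⟩ := hM f hf hdeg hs
  have : Fact ℓ.Prime := ⟨hℓ⟩
  exact ((padicValNat_dvd_iff_le (Nat.totient_eq_zero.not.2 (Int.natAbs_ne_zero.2 h0))).1
    (he.trans (totientGcd_dvd hn))).trans hle
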